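/- Fix an integer $n\ge 3$. Put $\mu=2\cos(\pi/3)=1$, $t=\mu+2\cos(\pi/n)$, and let $A=\begin{pmatrix}1&t\\0&1\end{pmatrix}$, $C=\begin{pmatrix}-\mu&1\\-1&0\end{pmatrix}$ act on $\mathbb R\cup\{\infty\}$ by Möbius transformations. For $\alpha\in[0,1]$ let $\ell_0(\alpha)=(\alpha-1)t$, $r_0(\alpha)=\alpha t$, $\mathbb I_\alpha=[\ell_0(\alpha),r_0(\alpha))$. For real $x\in[\ell_0(\alpha),r_0(\alpha)]$ the $\alpha$-digit of $x$ is $(k,l)$, where $l\ge 1$ is minimal with $C^l\cdot x\notin\mathbb I_\alpha$ and $k=-\lfloor (C^l\cdot x)/t+1-\alpha\rfloor$, and $T_\alpha(x)=A^kC^l\cdot x$ (both are undefined if $C^l\cdot x=\infty$). Let $\varepsilon_{3,n}$ be the $\varepsilon\in[0,1]$ with $A^{-1}C\cdot\ell_0(\varepsilon)=r_0(\varepsilon)$. *Words.* For a word $v=c_1d_1c_2\cdots d_{s-1}c_s$ in positive integers let $v'=1(c_1-1)d_1c_2\cdots c_s$ if $c_1\ne1$, and $v'=(d_1+1)c_2\cdots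 c_s$ if $c_1=1$, $s>1$ (in particular $c'=1(c-1)$ for a one-letter word $c>1$). Set $\Theta_{-1}(c)=c+1$ for one-letter words $c\ge1$; $\Theta_q(1)=1q1$ for $q\ge1$; $\Theta_q(c)=c\,[1(c-1)]^q\,1c$ for $c>1$, $q\ge0$; and, recursively, if $v=\Theta_p(u)=uv''$ with $p\ge0$, set $\Theta_q(v)=v(v')^qv''$ for $q\ge0$. ($\Theta_0(1)$ is undefined.) Let $\mathcal V$ be the tree of all words obtained from the word $1$ by finitely many applications of the $\Theta_q$; the suffix $v''$ used for a vertex $v$ is the one given by the parent $u$ of $v$ in the tree. *Cylinders and endpoints.* For $k\ge 2$ and $v=c_1d_1\cdots c_s\in\mathcal V$ let $\underline d(-k,v)=(-k)^{c_1},(-k-1)^{d_1},\dots,(-k-1)^{d_{s-1}},(-k)^{c_s}$, and let $\mathcal I_{-k,v}$ be the set of $\alpha\in[0,1]$ such that the sequence of $\alpha$-digits of $\ell_0(\alpha),T_\alpha(\ell_0(\alpha)),T_\alpha^2(\ell_0(\alpha)),\dots$ begins with $(e_1,1),(e_2,1),\dots,(e_m,1)$, where $e_1,\dots,e_m$ are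 the entries of $\underline d(-k,v)$ in order. Let $$L_{-k,v}=(A^{-k}C)^{c_s}(A^{-k-1}C)^{d_{s-1}}\cdots(A^{-k-1}C)^{d_1}(A^{-k}C)^{c_1}A^{-1},$$ and let $\zeta=\zeta_{-k,v}$ and $\eta=\eta_{-k,v}$ be the elements of $[0,1]$ with $$L_{-k,v}A\cdot\ell_0(\zeta)=r_0(\zeta),\qquad CA^{-1}CL_{-k,v}\cdot r_0(\eta)=C^{-1}\cdot\ell_0(\eta).$$ **Theorem.** The number $\varepsilon_{3,n}$ exists and is unique, and $$[\varepsilon_{3,n},1)=\bigcup_{k=2}^{\infty}\mathcal I_{-k,1},$$ the union being disjoint. Moreover, for every $k\ge2$ and every $v\in\mathcal V$, the numbers $\eta_{-k,v}$ and $\zeta_{-k,v}$ exist and are unique, $\eta_{-k,v}<\zeta_{-k,v}$, and, with $\mathcal J_{-k,v}=[\eta_{-k,v},\zeta_{-k,v})$, $$\mathcal I_{-k,v}=\mathcal J_{-k,v}\cup\bigcup_{q}\mathcal I_{-k,\Theta_q(v)},$$ where all the sets on the right-hand side are pairwise disjoint, and $q$ runs over all integers $q\ge0$ if $v$ has more than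 one letter, over all $q\ge-1$ if $v=c>1$ is a one-letter word, and over all $q\ge-1$ with $q\ne0$ if $v=1$. -/

import Mathlib

noncomputable section

namespace AlphaCF

open Set

/-! The groups `G_{3,n}` and the maps `T_{3,n,α}`. Möbius transformations act on `ℝ ∪ {∞}`, which is
`OnePoint ℝ` with Mathlib's action of `GL(2, ℝ)`; in particular `C • 0 = ∞`. -/

/-- `μ = 2 cos (π / 3)`. -/
def mu : ℝ := 2 * Real.cos (Real.pi / 3)

/-- `t = 2 cos (π / 3) + 2 cos (π / n)`. -/
def tPar (n : ℕ) : ℝ := mu + 2 * Real.cos (Real.pi / n)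

/-- The translation `A · x = x + t`. -/
def matA (n : ℕ) : GL (Fin 2) ℝ :=
  Matrix.GeneralLinearGroup.mkOfDetNeZero !![1, tPar n; 0, 1] (by simp [Matrix.det_fin_two_of])

/-- The rotation of order three `C · x = μ - 1 / x`. -/
def matC : GL (Fin 2) ℝ :=
  Matrix.GeneralLinearGroup.mkOfDetNeZero !![-mu, 1; -1, 0] (by simp [Matrix.det_fin_two_of])

/-- The left endpoint `ℓ₀(α) = (α - 1) t`. -/
def ell0 (n : ℕ) (α : ℝ) : ℝ := (α - 1) * tPar n

/-- The right endpoint `r₀(α) = α t`. -/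
def r0 (n : ℕ) (α : ℝ) : ℝ := α * tPar n

/-- The interval `𝕀_α = [ℓ₀(α), r₀(α))`, as a subset of `ℝ ∪ {∞}`. -/
def interval (n : ℕ) (α : ℝ) : Set (OnePoint ℝ) :=
  (fun x : ℝ => (x : OnePoint ℝ)) '' Ico (ell0 n α) (r0 n α)

/-- The `α`-digit of `x` is `(k, l)`: `l ≥ 1` is minimal with `C ^ l · x ∉ 𝕀_α`, and
`k = -⌊(C ^ l · x) / t + 1 - α⌋` (so a point with `C ^ l · x = ∞` has no digit). -/
def HasDigit (n : ℕ) (α x : ℝ) (k : ℤ) (l : ℕ) : Prop :=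
  1 ≤ l ∧ matC ^ l • (x : OnePoint ℝ) ∉ interval n α ∧
    (∀ j : ℕ, 1 ≤ j → j < l → matC ^ j • (x : OnePoint ℝ) ∈ interval n α) ∧
    ∃ z : ℝ, matC ^ l • (x : OnePoint ℝ) = (z : OnePoint ℝ) ∧ k = -⌊z / tPar n + 1 - α⌋

/-- `T_α x = y`, where `T_α x = A ^ k C ^ l · x` and `(k, l)` is the `α`-digit of `x`. -/
def MapsTo (n : ℕ) (α x y : ℝ) : Prop :=
  ∃ (k : ℤ) (l : ℕ), HasDigit n α x k l ∧
    matA n ^ k • matC ^ l • (x : OnePoint ℝ) = (y : OnePoint ℝ)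

/-- The sequence of `α`-digits of the `T_α`-orbit of `x` begins with the given simplified digits:
the successive digits are `(k₁, 1), (k₂, 1), …`. -/
def DigitsBegin (n : ℕ) (α : ℝ) : ℝ → List ℤ → Prop
  | _, [] => True
  | x, k :: ks => HasDigit n α x k 1 ∧ ∃ y : ℝ, MapsTo n α x y ∧ DigitsBegin n α y ks

/-! Words and the tree of words. A word `c₁ d₁ c₂ ⋯ d_{s-1} c_s` is a list of natural numbers. -/

/-- The lower digit sequence `(-k)^{c₁}, (-k-1)^{d₁}, …, (-k-1)^{d_{s-1}}, (-k)^{c_s}` of `-k` and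
the word `c₁ d₁ ⋯ d_{s-1} c_s`. -/
def lowerDigits (k : ℕ) : List ℕ → List ℤ
  | [] => []
  | [c] => List.replicate c (-(k : ℤ))
  | c :: d :: v =>
      List.replicate c (-(k : ℤ)) ++ (List.replicate d (-(k : ℤ) - 1) ++ lowerDigits k v)

/-- The word `v'`: replace the first letter `c₁ ≠ 1` by the two letters `1 (c₁ - 1)`; if `c₁ = 1`,
delete it and replace `d₁` by `d₁ + 1`. For one-letter words, `c' = 1 (c - 1)` and `1' = 1`. -/
def wordPrime : List ℕ → List ℕ
  | [] => []
  | [1] => [1]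
  | 1 :: d :: v => (d + 1) :: v
  | c :: v => 1 :: (c - 1) :: v

/-- A vertex of the tree: a word `v` together with the suffix `v''` for which `v = u v''`, where `u`
is the parent of `v`. For a one-letter word `v = c > 1` the second entry is `1 c`, so that
`Θ_q(c) = c (c')^q (1 c)` is an instance of `Θ_q(v) = v (v')^q v''`; for the root `v = 1` it is not
used. -/
structure Vertex where
  word : List ℕ
  tail : List ℕ

/-- The operators `Θ_q`:
* `Θ_{-1}(c) = c + 1` on one-letter words;
* `Θ_q(1) = 1 q 1` for `q ≥ 1`;
* `Θ_q(v) = v (v')^q v''` for every other `v` and `q ≥ 0`. -/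
def Theta (q : ℤ) (v : Vertex) : Vertex :=
  if v.word.length = 1 ∧ q = -1 then
    ⟨[v.word.headI + 1], [1, v.word.headI + 1]⟩
  else if v.word = [1] then
    ⟨[1, q.toNat, 1], [q.toNat, 1]⟩
  else
    ⟨v.word ++ ((List.replicate q.toNat (wordPrime v.word)).flatten ++ v.tail),
      (List.replicate q.toNat (wordPrime v.word)).flatten ++ v.tail⟩

/-- The set of `q` for which `Θ_q(v)` is defined: all `q ≥ q'`, where `q' = -1` if `v` is a one-letter
word and `q' = 0` otherwise, except that `Θ_0(1)` is undefined. -/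
def thetaIndices (v : Vertex) : Set ℤ :=
  {q | (if v.word.length = 1 then -1 else 0) ≤ q ∧ ¬(v.word = [1] ∧ q = 0)}

/-- The tree `𝒱`: everything obtained from the word `1` by finitely many applications of the
operators `Θ_q`. -/
inductive InTree : Vertex → Prop
  | root : InTree ⟨[1], []⟩
  | child (v : Vertex) (q : ℤ) : InTree v → q ∈ thetaIndices v → InTree (Theta q v)

/-! Cylinders and the endpoints of the synchronization intervals. -/

/-- The `α`-cylinder `𝓘_{-k,v}`: the parameters `α ∈ [0, 1]` for which the digit sequence of `ℓ₀(α)`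
begins with the lower digit sequence of `-k` and `v`. -/
def cylinder (n k : ℕ) (v : List ℕ) : Set ℝ :=
  {α | α ∈ Icc (0 : ℝ) 1 ∧ DigitsBegin n α (ell0 n α) (lowerDigits k v)}

/-- The left matrix
`L_{-k,v} = (A^{-k}C)^{c_s} (A^{-k-1}C)^{d_{s-1}} ⋯ (A^{-k-1}C)^{d₁} (A^{-k}C)^{c₁} A⁻¹`. -/
def leftMatrix (n k : ℕ) (v : List ℕ) : GL (Fin 2) ℝ :=
  (lowerDigits k v).foldl (fun M d => matA n ^ d * matC * M) (matA n)⁻¹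

/-- The equation `L_{-k,v} A · ℓ₀(ζ) = r₀(ζ)` that defines `ζ = ζ_{-k,v}`. -/
def IsZeta (n k : ℕ) (v : List ℕ) (ζ : ℝ) : Prop :=
  ζ ∈ Icc (0 : ℝ) 1 ∧
    (leftMatrix n k v * matA n) • (ell0 n ζ : OnePoint ℝ) = (r0 n ζ : OnePoint ℝ)

/-- The equation `C A⁻¹ C L_{-k,v} · r₀(η) = C⁻¹ · ℓ₀(η)` that defines `η = η_{-k,v}`. -/
def IsEta (n k : ℕ) (v : List ℕ) (η : ℝ) : Prop :=
  η ∈ Icc (0 : ℝ) 1 ∧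
    (matC * (matA n)⁻¹ * matC * leftMatrix n k v) • (r0 n η : OnePoint ℝ) =
      matC⁻¹ • (ell0 n η : OnePoint ℝ)

/-- The equation `A⁻¹ C · ℓ₀(ε) = r₀(ε)` that defines `ε = ε_{3,n}`. -/
def IsEpsilon (n : ℕ) (ε : ℝ) : Prop :=
  ε ∈ Icc (0 : ℝ) 1 ∧
    ((matA n)⁻¹ * matC) • (ell0 n ε : OnePoint ℝ) = (r0 n ε : OnePoint ℝ)

end AlphaCF

end

/-!
On a negative point `x`, the digit `(e, 1)` with `e ≤ -2` acts by the increasing map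
`digitMap t e : x ↦ 1 - 1 / x + e t`, and it is the digit of `x` exactly if the image lies in the
interval `[ℓ, ℓ + t)`, where `ℓ = ℓ₀(α)`. So `α` lies in a cylinder exactly if `ℓ` follows the
corresponding word (`Follows`, `digitsBegin_iff`), and the order of points is the lexicographic
order of their digits (`Follows.lt_of_digit_lt`, `Follows.digit_or`).

In the letters `e = -k` and `e - 1`, a vertex of the tree is a word `v = u π e` with parent `u`, where
`v' = π (e - 1) u` differs from `v` only in its first letter, and the children of `v` are the words
`v v' ⋯ v' π e` (`IsNode`, `Represents.child`). The condition defining `η` says that `v` sends `ℓ` to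
the synchronization point `s = C⁻¹ A C · ℓ`, and `s` has the same image under the digit `e - 1` as `ℓ`
under `e`. Hence `v'` sends `s` to the point `x` to which `v` sends `ℓ`.

Fix `α` in the cylinder of `v`. If `x < s`, then `x` lies between the image of `ℓ` under `u`, whose
next digits are `π e`, and the point `s`, whose next digits are `π (e - 1) u = v'`. So `x` either
follows `π e`, or it follows all of `v'`, to a point further to the left in the same range. Since
digit maps do not contract distances on `[-1, 0)`, the second case cannot occur forever, and `α` lies
in the cylinder of exactly one child (`IsNode.exists_follows`, `child_index_unique`). If `x ≥ s`, then
`α` lies in no child (`IsNode.lt_syncPoint`).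

It remains to see that the `α` in the cylinder with `x ≥ s` form the interval `[η, ζ)`
(`IsNode.sync_iff`). The equations for `η` and `ζ` are quadratic in `ℓ`, with a sign change between
the ends of `[-t, 0]`, so each has a unique root there. As `ℓ` increases, orbits move to the right at
least as fast as `ℓ` does, so once `ℓ` follows `v` it does so up to `ζ` (`Follows.extend`); and there
is a parameter to the left of `η` at which `ℓ` follows `v`, namely one at which `v` and `u` send `ℓ`
to the same point (`IsNode.exists_start`).
-/

namespace AlphaCF

open Set

variable {t ℓ : ℝ}

/-! ### Orbits under prescribed digits -/

/-- The map `x ↦ A ^ e C · x = 1 - 1 / x + e t` of a simplified digit `(e, 1)`. -/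
noncomputable def digitMap (t : ℝ) (e : ℤ) (x : ℝ) : ℝ := 1 - 1 / x + e * t

/-- The image of `x` under the successive digit maps of the word `w`, first letter first. -/
noncomputable def digitOrbit (t x : ℝ) (w : List ℤ) : ℝ := w.foldl (fun y e => digitMap t e y) x

/-- The point `y` follows the digits `w` in the interval `[ℓ, ℓ + t)`: each point to which a digit
is applied is negative, and its image lies in the interval. -/
def Follows (t ℓ : ℝ) : ℝ → List ℤ → Prop
  | _, [] => True
  | y, e :: w => y < 0 ∧ ℓ ≤ digitMap t e y ∧ digitMap t e y < ℓ + t ∧ Follows t ℓ (digitMap t e y) w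

@[simp] lemma digitOrbit_nil (x : ℝ) : digitOrbit t x [] = x := rfl

@[simp] lemma digitOrbit_cons (x : ℝ) (e : ℤ) (w : List ℤ) :
    digitOrbit t x (e :: w) = digitOrbit t (digitMap t e x) w := rfl

@[simp] lemma digitOrbit_append (x : ℝ) (w w' : List ℤ) :
    digitOrbit t x (w ++ w') = digitOrbit t (digitOrbit t x w) w' := by
  simp [digitOrbit, List.foldl_append]

@[simp] lemma follows_nil (y : ℝ) : Follows t ℓ y [] := trivial

lemma follows_cons {y : ℝ} {e : ℤ} {w : List ℤ} :
    Follows t ℓ y (e :: w) ↔ y < 0 ∧ ℓ ≤ digitMap t e y ∧ digitMap t e y < ℓ + t ∧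
      Follows t ℓ (digitMap t e y) w := Iff.rfl

lemma follows_append {y : ℝ} {w w' : List ℤ} :
    Follows t ℓ y (w ++ w') ↔ Follows t ℓ y w ∧ Follows t ℓ (digitOrbit t y w) w' := by
  induction w generalizing y with
  | nil => simp
  | cons e w ih => simp [follows_cons, ih, and_assoc]

lemma follows_singleton {y : ℝ} {e : ℤ} :
    Follows t ℓ y [e] ↔ y < 0 ∧ ℓ ≤ digitMap t e y ∧ digitMap t e y < ℓ + t := by
  simp [follows_cons]

lemma le_digitOrbit {y : ℝ} {w : List ℤ} (hy : ℓ ≤ y) (h : Follows t ℓ y w) :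
    ℓ ≤ digitOrbit t y w := by
  induction w generalizing y with
  | nil => simpa
  | cons e w ih => exact ih h.2.1 h.2.2.2

lemma digitMap_sub {x y : ℝ} (hx : x < 0) (hy : y < 0) (e : ℤ) :
    digitMap t e y - digitMap t e x = (y - x) / (x * y) := by
  have := hx.ne; have := hy.ne
  unfold digitMap; field_simp; ring

/-- Digit maps are increasing on the negative reals. -/
lemma digitMap_mono {x y : ℝ} (hxy : x ≤ y) (hy : y < 0) (e : ℤ) :
    digitMap t e x ≤ digitMap t e y := by
  have h := digitMap_sub (t := t) (hxy.trans_lt hy) hy e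
  have : 0 ≤ (y - x) / (x * y) :=
    div_nonneg (sub_nonneg.2 hxy) (mul_pos_of_neg_of_neg (hxy.trans_lt hy) hy).le
  linarith

/-- Digit maps do not contract distances on `[-1, 0)`. -/
lemma digitMap_expand {x y : ℝ} (hx : -1 ≤ x) (hxy : x ≤ y) (hy : y < 0) (e : ℤ) :
    y - x ≤ digitMap t e y - digitMap t e x := by
  rw [digitMap_sub (hxy.trans_lt hy) hy]
  rw [le_div_iff₀ (mul_pos_of_neg_of_neg (hxy.trans_lt hy) hy)]
  have h1 : x * y ≤ 1 := by nlinarith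
  nlinarith

lemma digitMap_pred (e : ℤ) (x : ℝ) : digitMap t (e - 1) x = digitMap t e x - t := by
  unfold digitMap; push_cast; ring

lemma digitOrbit_expand {x y : ℝ} {w : List ℤ} (hℓ : -1 ≤ ℓ) (hx : ℓ ≤ x) (hxy : x ≤ y)
    (h1 : Follows t ℓ x w) (h2 : Follows t ℓ y w) :
    y - x ≤ digitOrbit t y w - digitOrbit t x w := by
  induction w generalizing x y with
  | nil => simp
  | cons e w ih =>
    have := digitMap_expand (t := t) (hℓ.trans hx) hxy h2.1 e
    exact this.trans (ih h1.2.1 (by linarith) h1.2.2.2 h2.2.2.2)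

lemma digitOrbit_mono {x y : ℝ} {w : List ℤ} (hxy : x ≤ y)
    (h1 : Follows t ℓ x w) (h2 : Follows t ℓ y w) :
    digitOrbit t x w ≤ digitOrbit t y w := by
  induction w generalizing x y with
  | nil => simpa
  | cons e w ih => exact ih (digitMap_mono hxy h2.1 e) h1.2.2.2 h2.2.2.2

lemma Follows.of_mem_Icc {x y z : ℝ} {w : List ℤ} (hxy : x ≤ y) (hyz : y ≤ z)
    (h1 : Follows t ℓ x w) (h2 : Follows t ℓ z w) : Follows t ℓ y w := by
  induction w generalizing x y z with
  | nil => trivial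
  | cons e w ih =>
    have hy := hyz.trans_lt h2.1
    have e1 := digitMap_mono (t := t) hxy hy e
    have e2 := digitMap_mono (t := t) hyz h2.1 e
    exact ⟨hy, h1.2.1.trans e1, e2.trans_lt h2.2.2.1, ih e1 e2 h1.2.2.2 h2.2.2.2⟩

/-- The order of points is the lexicographic order of their digits, the digit `e - 1` being larger
than the digit `e`. -/
lemma Follows.lt_of_digit_lt {x y : ℝ} {w : List ℤ} {e : ℤ}
    (h1 : Follows t ℓ x (w ++ [e])) (h2 : Follows t ℓ y (w ++ [e - 1])) : x < y := by
  by_contra! hle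
  rw [follows_append, follows_singleton] at h1 h2
  have hm := digitOrbit_mono hle h2.1 h1.1
  have := digitMap_mono (t := t) hm h1.2.1 e
  rw [digitMap_pred] at h2
  linarith [h1.2.2.2, h2.2.2.1]

/-- A point between two points whose digits first differ after `w`, by one, has one of their
digits there. -/
lemma Follows.digit_or {x y z : ℝ} {w : List ℤ} {e : ℤ} (hxy : x ≤ y) (hyz : y ≤ z)
    (h1 : Follows t ℓ x (w ++ [e])) (h2 : Follows t ℓ z (w ++ [e - 1])) :
    Follows t ℓ y (w ++ [e]) ∨ Follows t ℓ y (w ++ [e - 1]) := by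
  simp only [follows_append, follows_singleton] at *
  have hw := h1.1.of_mem_Icc hxy hyz h2.1
  have m1 := digitOrbit_mono hxy h1.1 hw
  have m2 := digitOrbit_mono hyz hw h2.1
  have hneg := m2.trans_lt h2.2.1
  have e1 := digitMap_mono (t := t) m1 hneg e
  have e2 := digitMap_mono (t := t) m2 h2.2.1 (e - 1)
  rcases lt_or_ge (digitMap t (e - 1) (digitOrbit t y w)) ℓ with h | h
  · left
    rw [digitMap_pred] at h
    exact ⟨hw, hneg, h1.2.2.1.trans e1, by linarith⟩
  · exact Or.inr ⟨hw, hneg, h, e2.trans_lt h2.2.2.2⟩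

/-! ### Nodes of the tree -/

/-- The `j`-th power of a word. -/
def wpow (w : List ℤ) (j : ℕ) : List ℤ := (List.replicate j w).flatten

@[simp] lemma wpow_zero (w : List ℤ) : wpow w 0 = [] := rfl

lemma wpow_succ (w : List ℤ) (j : ℕ) : wpow w (j + 1) = w ++ wpow w j := by
  simp [wpow, List.replicate_succ]

lemma wpow_succ' (w : List ℤ) (j : ℕ) : wpow w (j + 1) = wpow w j ++ w := by
  simp [wpow, List.replicate_succ']

/-- The pairs of words `(u, π)` attached to the vertices of the tree, in the letters `e` and `e - 1`;
the variable `p` stands for `π`. The vertex itself is the word `v = u π e`, with parent `u` (empty for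
the root), and `v' = π (e - 1) u`. The children of `v` are the words `v v' ⋯ v' π e` with `j ≥ 0`
factors `v'`, so the pair of such a child is `(v, v' ⋯ v' π)`. -/
inductive IsNode (e : ℤ) : List ℤ → List ℤ → Prop
  | root : IsNode e [] []
  | child (u p : List ℤ) (j : ℕ) : IsNode e u p →
      IsNode e (u ++ (p ++ [e])) (wpow (p ++ (e - 1) :: u) j ++ p)

/-- The words `v` and `v'` differ only in their first letters. -/
lemma IsNode.exists_cons {e : ℤ} {u p : List ℤ} (h : IsNode e u p) :
    ∃ y, u ++ (p ++ [e]) = e :: y ∧ p ++ (e - 1) :: u = (e - 1) :: y := by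
  induction h with
  | root => exact ⟨[], rfl, rfl⟩
  | child u p j _ ih =>
    obtain ⟨y, h1, h2⟩ := ih
    refine ⟨y ++ (wpow (p ++ (e - 1) :: u) j ++ (p ++ [e])), ?_, ?_⟩
    · rw [h1]; simp
    · have : wpow (p ++ (e - 1) :: u) j ++ p ++ (e - 1) :: (u ++ (p ++ [e])) =
          wpow (p ++ (e - 1) :: u) j ++ (p ++ (e - 1) :: u) ++ (p ++ [e]) := by simp
      rw [this, ← wpow_succ', wpow_succ]
      nth_rewrite 1 [h2]
      simp

/-- The parent `u` of `v` is a proper suffix of `v`. -/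
lemma IsNode.exists_suffix {e : ℤ} {u p : List ℤ} (h : IsNode e u p) :
    ∃ w, w ≠ [] ∧ u ++ (p ++ [e]) = w ++ u := by
  obtain ⟨y, h1, h2⟩ := h.exists_cons
  cases p with
  | nil =>
    obtain rfl : u = y := by simpa using h2
    exact ⟨[e], by simp, h1⟩
  | cons b p =>
    simp only [List.cons_append, List.cons.injEq] at h2
    refine ⟨e :: p ++ [e - 1], by simp, ?_⟩
    rw [h1, ← h2.2]
    simp

/-- The point `ℓ / (1 - t ℓ) = C⁻¹ A C · ℓ`. -/
noncomputable def syncPoint (t ℓ : ℝ) : ℝ := ℓ / (1 - t * ℓ)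

lemma syncPoint_neg (ht : 2 ≤ t) (hℓ : ℓ < 0) : syncPoint t ℓ < 0 :=
  div_neg_of_neg_of_pos hℓ (by nlinarith)

lemma digitMap_syncPoint (ht : 2 ≤ t) (hℓ : ℓ < 0) (e : ℤ) :
    digitMap t (e - 1) (syncPoint t ℓ) = digitMap t e ℓ := by
  have := hℓ.ne
  have h2 : 1 - t * ℓ ≠ 0 := by nlinarith
  unfold digitMap syncPoint
  push_cast
  field_simp
  ring

section Fiber

variable {e : ℤ} {u p : List ℤ}

/-- The synchronization point follows `v'`, to the same point as `ℓ` under `v`. -/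
lemma IsNode.follows_syncPoint (hn : IsNode e u p) (ht : 2 ≤ t)
    (hv : Follows t ℓ ℓ (u ++ (p ++ [e]))) :
    Follows t ℓ (syncPoint t ℓ) (p ++ (e - 1) :: u) ∧
      digitOrbit t (syncPoint t ℓ) (p ++ (e - 1) :: u) = digitOrbit t ℓ (u ++ (p ++ [e])) := by
  obtain ⟨y, h1, h2⟩ := hn.exists_cons
  rw [h1] at hv ⊢
  rw [h2, digitOrbit_cons, digitOrbit_cons, follows_cons, digitMap_syncPoint ht hv.1]
  exact ⟨⟨syncPoint_neg ht hv.1, hv.2⟩, rfl⟩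

/-- The orbit of `ℓ` after the digits `u` lies left of the synchronization point. -/
lemma IsNode.digitOrbit_parent_lt (hn : IsNode e u p) (ht : 2 ≤ t)
    (hv : Follows t ℓ ℓ (u ++ (p ++ [e]))) : digitOrbit t ℓ u < syncPoint t ℓ := by
  have h1 := (follows_append.1 hv).2
  have h2 := (hn.follows_syncPoint ht hv).1
  rw [List.append_cons, follows_append] at h2
  exact h1.lt_of_digit_lt h2.1

/-- A point between the orbit of `ℓ` after `u` and the synchronization point either follows `π e`,
or follows `v'` to a smaller point, which is again to the right of the orbit of `ℓ` after `u`. -/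
lemma IsNode.dichotomy (hn : IsNode e u p) (ht : 2 ≤ t)
    (hv : Follows t ℓ ℓ (u ++ (p ++ [e]))) {y : ℝ} (h1 : digitOrbit t ℓ u ≤ y)
    (h2 : y ≤ syncPoint t ℓ) :
    Follows t ℓ y (p ++ [e]) ∨ (Follows t ℓ y (p ++ (e - 1) :: u) ∧
      digitOrbit t ℓ u ≤ digitOrbit t y (p ++ (e - 1) :: u) ∧
      digitOrbit t y (p ++ (e - 1) :: u) ≤ digitOrbit t ℓ (u ++ (p ++ [e]))) := by
  have hs := hn.follows_syncPoint ht hv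
  have hv' := follows_append.1 hv
  rw [List.append_cons p (e - 1) u] at hs ⊢
  have hs1 := follows_append.1 hs.1
  rcases hv'.2.digit_or h1 h2 hs1.1 with h | h
  · exact Or.inl h
  · right
    have hge : ℓ ≤ digitOrbit t y (p ++ [e - 1]) := by
      rw [digitOrbit_append]
      exact (follows_singleton.1 (follows_append.1 h).2).2.1
    have hle := digitOrbit_mono h2 h hs1.1
    have hu := hv'.1.of_mem_Icc hge hle hs1.2
    refine ⟨follows_append.2 ⟨h, hu⟩, ?_, ?_⟩
    · rw [digitOrbit_append _ (p ++ [e - 1])]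
      exact digitOrbit_mono hge hv'.1 hu
    · rw [← hs.2]
      exact digitOrbit_mono h2 (follows_append.2 ⟨h, hu⟩) hs.1

/-- Iterating `v'` from a point that it moves to the left, the orbit eventually follows `π e`: the
steps to the left do not get shorter, and the orbit stays to the right of `digitOrbit t ℓ u`. -/
lemma IsNode.exists_follows (hn : IsNode e u p) (ht : 2 ≤ t) (hℓ : -1 ≤ ℓ)
    (hv : Follows t ℓ ℓ (u ++ (p ++ [e])))
    (hlt : digitOrbit t ℓ (u ++ (p ++ [e])) < syncPoint t ℓ) :
    ∃ j, Follows t ℓ ℓ (u ++ (p ++ [e]) ++ (wpow (p ++ (e - 1) :: u) j ++ (p ++ [e]))) := by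
  set v' := p ++ (e - 1) :: u with hv'
  set x := digitOrbit t ℓ (u ++ (p ++ [e])) with hx
  have hneg : ℓ < 0 := by
    obtain ⟨y, h1, -⟩ := hn.exists_cons
    rw [h1] at hv
    exact hv.1
  have hux : digitOrbit t ℓ u ≤ x := by
    obtain ⟨w, -, hw⟩ := hn.exists_suffix
    have h := hv
    rw [hw, follows_append] at h
    rw [hx, hw, digitOrbit_append]
    exact digitOrbit_mono (le_digitOrbit le_rfl h.1) (follows_append.1 hv).1 h.2
  have hu : ℓ ≤ digitOrbit t ℓ u := le_digitOrbit le_rfl (follows_append.1 hv).1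
  have hs := hn.follows_syncPoint ht hv
  set δ := syncPoint t ℓ - x with hδ
  by_contra! hno
  -- The orbit of `x` under `v'` never stops, and each step has length at least `δ`.
  have key : ∀ j : ℕ, Follows t ℓ x (wpow v' j) ∧ digitOrbit t ℓ u ≤ digitOrbit t x (wpow v' j) ∧
      ∃ z, digitOrbit t x (wpow v' j) + δ ≤ z ∧ z ≤ syncPoint t ℓ - j * δ ∧ z ≤ syncPoint t ℓ ∧
        Follows t ℓ z v' ∧ digitOrbit t z v' = digitOrbit t x (wpow v' j) := by
    intro j
    induction j with
    | zero => exact ⟨trivial, hux, syncPoint t ℓ, by simp [hδ], by simp, le_rfl, hs⟩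
    | succ j ih =>
      obtain ⟨hf, hge, z, hz1, hz2, hz3, hz4, hz5⟩ := ih
      set y := digitOrbit t x (wpow v' j)
      have hδ0 : 0 < δ := sub_pos.2 hlt
      rcases hn.dichotomy ht hv hge (by linarith) with h | h
      · exact absurd (follows_append.2 ⟨hv, follows_append.2 ⟨hf, h⟩⟩) (hno j)
      · rw [wpow_succ', digitOrbit_append]
        refine ⟨follows_append.2 ⟨hf, h.1⟩, h.2.1, y, ?_, ?_, by linarith, h.1, rfl⟩
        · have := digitOrbit_expand hℓ (hu.trans hge) (by linarith : y ≤ z) h.1 hz4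
          change digitOrbit t y v' + δ ≤ y
          linarith
        · push_cast; linarith
  obtain ⟨j, hj⟩ := exists_nat_gt ((syncPoint t ℓ - digitOrbit t ℓ u) / δ)
  obtain ⟨-, hge, z, hz1, hz2, -⟩ := key j
  have hδ0 : 0 < δ := sub_pos.2 hlt
  rw [div_lt_iff₀ hδ0] at hj
  linarith

/-- Conversely, if the digits of `ℓ` continue as for a child, then `v` moves `ℓ` to the left of the
synchronization point. -/
lemma IsNode.lt_syncPoint (hn : IsNode e u p) (ht : 2 ≤ t) {j : ℕ}
    (h : Follows t ℓ ℓ (u ++ (p ++ [e]) ++ (wpow (p ++ (e - 1) :: u) j ++ (p ++ [e])))) :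
    digitOrbit t ℓ (u ++ (p ++ [e])) < syncPoint t ℓ := by
  obtain ⟨hv, h⟩ := follows_append.1 h
  have hs := hn.follows_syncPoint ht hv
  by_contra! hle
  have key : ∀ j x, syncPoint t ℓ ≤ x →
      ¬ Follows t ℓ x (wpow (p ++ (e - 1) :: u) j ++ (p ++ [e])) := by
    intro j
    induction j with
    | zero =>
      intro x hx h0
      have h2 := hs.1
      rw [List.append_cons, follows_append] at h2
      have h0' : Follows t ℓ x (p ++ [e]) := h0
      exact absurd (h0'.lt_of_digit_lt h2.1) (not_lt.2 hx)
    | succ j ih =>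
      intro x hx h0
      rw [wpow_succ, List.append_assoc, follows_append] at h0
      refine ih _ (hle.trans ?_) h0.2
      rw [← hs.2]
      exact digitOrbit_mono hx hs.1 h0.1
  exact key j _ hle h

/-- The digits of a point cannot continue as for two different children. -/
lemma child_index_unique {y : ℝ} {i j : ℕ}
    (hi : Follows t ℓ y (wpow (p ++ (e - 1) :: u) i ++ (p ++ [e])))
    (hj : Follows t ℓ y (wpow (p ++ (e - 1) :: u) j ++ (p ++ [e]))) : i = j := by
  have key : ∀ {y : ℝ} {m : ℕ}, Follows t ℓ y (p ++ [e]) →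
      ¬ Follows t ℓ y (wpow (p ++ (e - 1) :: u) (m + 1) ++ (p ++ [e])) := by
    intro y m h h'
    rw [wpow_succ, List.append_assoc, follows_append, List.append_cons, follows_append] at h'
    exact lt_irrefl y (h.lt_of_digit_lt h'.1.1)
  induction i generalizing j y with
  | zero =>
    cases j with
    | zero => rfl
    | succ j => exact absurd hj (key hi)
  | succ i ih =>
    cases j with
    | zero => exact absurd hi (key hj)
    | succ j =>
      rw [wpow_succ, List.append_assoc, follows_append] at hi hj
      rw [ih hi.2 hj.2]

end Fiber

/-! ### Transfer matrices -/

/-- The matrix of the Möbius transformation `x ↦ digitOrbit t x w`. -/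
noncomputable def transfer (t : ℝ) (w : List ℤ) : Matrix (Fin 2) (Fin 2) ℝ :=
  w.foldl (fun M (e : ℤ) => !![-(1 + e * t), 1; -1, 0] * M) 1

/-- The numerator of the Möbius transformation `transfer t w` at `x`. -/
noncomputable def num (t : ℝ) (w : List ℤ) (x : ℝ) : ℝ := transfer t w 0 0 * x + transfer t w 0 1

/-- The denominator of the Möbius transformation `transfer t w` at `x`. -/
noncomputable def den (t : ℝ) (w : List ℤ) (x : ℝ) : ℝ := transfer t w 1 0 * x + transfer t w 1 1

lemma transfer_append (w : List ℤ) (e : ℤ) :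
    transfer t (w ++ [e]) = !![-(1 + e * t), 1; -1, 0] * transfer t w := by
  simp [transfer]

lemma transfer_append_apply (w : List ℤ) (e : ℤ) (j : Fin 2) :
    transfer t (w ++ [e]) 0 j = -(1 + e * t) * transfer t w 0 j + transfer t w 1 j ∧
    transfer t (w ++ [e]) 1 j = -transfer t w 0 j := by
  rw [transfer_append]
  constructor <;> simp [Matrix.mul_apply, Fin.sum_univ_two]

lemma num_append (w : List ℤ) (e : ℤ) (x : ℝ) :
    num t (w ++ [e]) x = -(1 + e * t) * num t w x + den t w x := by
  simp only [num, den, transfer_append_apply]; ring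

lemma den_append (w : List ℤ) (e : ℤ) (x : ℝ) : den t (w ++ [e]) x = -num t w x := by
  simp only [num, den, transfer_append_apply]; ring

@[simp] lemma num_nil (x : ℝ) : num t [] x = x := by simp [num, transfer]

@[simp] lemma den_nil (x : ℝ) : den t [] x = 1 := by simp [den, transfer]

lemma transfer_det (w : List ℤ) :
    transfer t w 0 0 * transfer t w 1 1 - transfer t w 0 1 * transfer t w 1 0 = 1 := by
  induction w using List.reverseRecOn with
  | nil => simp [transfer]
  | append_singleton w e ih => simp only [transfer_append_apply]; linarith

lemma num_den_det (w : List ℤ) (x : ℝ) :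
    transfer t w 0 0 * den t w x - transfer t w 1 0 * num t w x = 1 := by
  rw [← transfer_det (t := t) w, num, den]; ring

/-- The signs and relative sizes of the entries of a transfer matrix. -/
lemma transfer_signs (ht : 2 ≤ t) {w : List ℤ} (hw : ∀ e ∈ w, e ≤ -2) (hne : w ≠ []) :
    transfer t w 1 0 < 0 ∧ -transfer t w 1 0 ≤ transfer t w 0 0 ∧ transfer t w 1 1 ≤ 0 ∧
      -transfer t w 1 1 ≤ transfer t w 0 1 ∧ 0 < transfer t w 0 1 ∧
      transfer t w 1 0 < transfer t w 1 1 ∧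
      transfer t w 1 1 - transfer t w 1 0 ≤ transfer t w 0 0 - transfer t w 0 1 := by
  induction w using List.reverseRecOn with
  | nil => exact absurd rfl hne
  | append_singleton w e ih =>
    have he : (e : ℝ) ≤ -2 := by exact_mod_cast hw e (by simp)
    have hK : 3 ≤ -(1 + e * t) := by nlinarith
    simp only [transfer_append_apply]
    set K := -(1 + e * t)
    rcases eq_or_ne w [] with rfl | h
    · norm_num [transfer]
      exact ⟨by linarith, by linarith⟩
    · obtain ⟨h1, h2, h3, h4, h5, h6, h7⟩ := ih (fun e he => hw e (by simp [he])) h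
      refine ⟨?_, ?_, ?_, ?_, ?_, ?_, ?_⟩ <;> nlinarith

lemma transfer_signs_weak (ht : 2 ≤ t) {w : List ℤ} (hw : ∀ e ∈ w, e ≤ -2) :
    transfer t w 1 0 ≤ 0 ∧ 0 < transfer t w 0 0 := by
  rcases eq_or_ne w [] with rfl | h
  · simp [transfer]
  · have := transfer_signs ht hw h
    exact ⟨this.1.le, by linarith⟩

lemma Follows.digitOrbit_eq {w : List ℤ} (h : Follows t ℓ ℓ w) :
    0 < den t w ℓ ∧ digitOrbit t ℓ w = num t w ℓ / den t w ℓ := by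
  induction w using List.reverseRecOn with
  | nil => simp
  | append_singleton w e ih =>
    rw [follows_append, follows_singleton] at h
    obtain ⟨h1, h2⟩ := ih h.1
    have hneg := h.2.1
    rw [h2, div_neg_iff] at hneg
    have hN : num t w ℓ < 0 := by
      rcases hneg with h | h
      · exact absurd h.2 (not_lt.2 h1.le)
      · exact h.1
    rw [den_append, num_append, digitOrbit_append, h2]
    refine ⟨by linarith, ?_⟩
    have := hN.ne
    have := h1.ne'
    simp only [digitOrbit_cons, digitOrbit_nil, digitMap]
    field_simp
    ring

lemma den_pos_of_append (ht : 2 ≤ t) {w : List ℤ} (hw : ∀ e ∈ w, e ≤ -2) {e : ℤ} {x : ℝ}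
    (h : 0 < den t (w ++ [e]) x) : num t w x < 0 ∧ 0 < den t w x := by
  rw [den_append] at h
  have := num_den_det (t := t) w x
  obtain ⟨h1, h2⟩ := transfer_signs_weak ht hw
  have hN : num t w x < 0 := by linarith
  refine ⟨hN, ?_⟩
  by_contra! hd
  nlinarith

/-- If the left endpoint `a` follows `w`, then so does every larger left endpoint `x`, up to the
bound on the last image, as long as the denominator stays positive: the orbit of `x` moves to the
right at least as fast as `x`. -/
lemma Follows.extend (ht : 2 ≤ t) {w : List ℤ} (hw : ∀ e ∈ w, e ≤ -2) {a x : ℝ} (ha : -1 ≤ a)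
    (hax : a ≤ x) (h : Follows t a a w) (hd : 0 < den t w x) :
    digitOrbit t x w = num t w x / den t w x ∧
      digitOrbit t a w + (x - a) ≤ digitOrbit t x w ∧
      (digitOrbit t x w < x + t → Follows t x x w) := by
  induction w using List.reverseRecOn with
  | nil => simp
  | append_singleton w e ih =>
    rw [follows_append, follows_singleton] at h
    have hw' : ∀ e ∈ w, e ≤ -2 := fun e he => hw e (by simp [he])
    obtain ⟨hN, hD⟩ := den_pos_of_append ht hw' hd
    obtain ⟨i1, i2, i3⟩ := ih hw' h.1 hD
    have hneg : digitOrbit t x w < 0 := by rw [i1]; exact div_neg_of_neg_of_pos hN hD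
    have hge := le_digitOrbit le_rfl h.1
    have hex := digitMap_expand (t := t) (ha.trans hge) (by linarith) hneg e
    have hf := i3 (by linarith)
    simp only [digitOrbit_append, digitOrbit_cons, digitOrbit_nil]
    refine ⟨?_, by linarith, fun hlt => ?_⟩
    · have := hN.ne
      have := hD.ne'
      rw [num_append, den_append, i1, digitMap]
      field_simp
      ring
    · rw [follows_append, follows_singleton]
      exact ⟨hf, hneg, by linarith [h.2.2.1], hlt⟩

lemma Follows.extend_prefix (ht : 2 ≤ t) {w : List ℤ} {e : ℤ} (hw : ∀ e ∈ w, e ≤ -2) {a x : ℝ}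
    (ha : -1 ≤ a) (hax : a ≤ x) (h : Follows t a a w) (hd : 0 < den t (w ++ [e]) x) :
    digitOrbit t x w < 0 ∧ Follows t x x w := by
  obtain ⟨hN, hD⟩ := den_pos_of_append ht hw hd
  obtain ⟨i1, i2, i3⟩ := h.extend ht hw ha hax hD
  have hneg : digitOrbit t x w < 0 := by rw [i1]; exact div_neg_of_neg_of_pos hN hD
  exact ⟨hneg, i3 (by linarith)⟩

/-! ### Endpoints of the synchronization intervals -/

/-- A quadratic polynomial that changes sign on an interval has exactly one root there, since its
other linear factor has the same sign at both ends. -/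
lemma exists_root_of_sign_change {A B C lo hi : ℝ} {q : ℝ → ℝ}
    (hq : ∀ x, q x = A * x ^ 2 + B * x + C) (hlh : lo ≤ hi) (hlo : 0 < q lo) (hhi : q hi < 0) :
    ∃ r, lo < r ∧ r < hi ∧
      ∀ x, lo ≤ x → x ≤ hi → (0 < q x ↔ x < r) ∧ (q x = 0 ↔ x = r) := by
  have hcont : Continuous q := by
    rw [show q = fun x => A * x ^ 2 + B * x + C from funext hq]; fun_prop
  obtain ⟨r, ⟨hr1, hr2⟩, hr⟩ := intermediate_value_Ioo' hlh hcont.continuousOn ⟨hhi, hlo⟩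
  refine ⟨r, hr1, hr2, fun x hx1 hx2 => ?_⟩
  have hfac : ∀ x, q x = (x - r) * (A * (x + r) + B) := by
    intro x
    have h1 := hq x
    have h2 := hq r
    linear_combination h1 - h2 + hr
  have hL1 : A * (lo + r) + B < 0 := by
    have := hfac lo
    by_contra! h
    nlinarith
  have hL2 : A * (hi + r) + B < 0 := by
    have := hfac hi
    by_contra! h
    nlinarith
  have hL : A * (x + r) + B < 0 := by
    rcases le_total 0 A with h | h
    · linarith [mul_le_mul_of_nonneg_left hx2 h]
    · linarith [mul_le_mul_of_nonpos_left hx1 h]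
  rw [hfac x]
  constructor
  · constructor
    · intro h
      by_contra! hle
      nlinarith
    · intro h
      exact mul_pos_of_neg_of_neg (by linarith) hL
  · rw [mul_eq_zero, or_iff_left hL.ne, sub_eq_zero]

/-- The quadratic polynomial whose root in `[-t, 0]` is the parameter at which `w` maps the left
endpoint of the interval to its right endpoint. -/
noncomputable def zetaPoly (t : ℝ) (w : List ℤ) (x : ℝ) : ℝ := (x + t) * den t w x - num t w x

/-- The quadratic polynomial whose root in `[-t, 0]` is the parameter at which `w` maps the left
endpoint of the interval to the synchronization point. -/
noncomputable def etaPoly (t : ℝ) (w : List ℤ) (x : ℝ) : ℝ :=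
  x * den t w x - (1 - t * x) * num t w x

lemma exists_zetaPoly_root (ht : 2 ≤ t) {w : List ℤ} (hw : ∀ e ∈ w, e ≤ -2) (hne : w ≠ []) :
    ∃ r, -t < r ∧ r < 0 ∧ ∀ x, -t ≤ x → x ≤ 0 →
      (0 < zetaPoly t w x ↔ x < r) ∧ (zetaPoly t w x = 0 ↔ x = r) := by
  obtain ⟨h1, h2, h3, h4, h5, h6, h7⟩ := transfer_signs ht hw hne
  refine exists_root_of_sign_change (A := transfer t w 1 0)
    (B := transfer t w 1 1 + t * transfer t w 1 0 - transfer t w 0 0)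
    (C := t * transfer t w 1 1 - transfer t w 0 1)
    (fun x => by simp only [zetaPoly, num, den]; ring) (by linarith) ?_ ?_
  · simp only [zetaPoly, num, den]
    nlinarith
  · simp only [zetaPoly, num, den]
    nlinarith

lemma exists_etaPoly_root (ht : 2 ≤ t) {w : List ℤ} (hw : ∀ e ∈ w, e ≤ -2) (hne : w ≠ []) :
    ∃ r, -t < r ∧ r < 0 ∧ ∀ x, -t ≤ x → x ≤ 0 →
      (0 < etaPoly t w x ↔ x < r) ∧ (etaPoly t w x = 0 ↔ x = r) := by
  obtain ⟨h1, h2, h3, h4, h5, h6, h7⟩ := transfer_signs ht hw hne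
  refine exists_root_of_sign_change (A := transfer t w 1 0 + t * transfer t w 0 0)
    (B := transfer t w 1 1 - transfer t w 0 0 + t * transfer t w 0 1)
    (C := -transfer t w 0 1)
    (fun x => by simp only [etaPoly, num, den]; ring) (by linarith) ?_ ?_
  · simp only [etaPoly, num, den]
    have k1 : transfer t w 0 0 ≤ transfer t w 0 0 * t - transfer t w 0 1 := by nlinarith
    have k2 : (1 + t * t) * transfer t w 0 0 ≤
        (1 + t * t) * (transfer t w 0 0 * t - transfer t w 0 1) :=
      mul_le_mul_of_nonneg_left k1 (by positivity)
    have k3 : t * t * -transfer t w 1 0 ≤ t * t * transfer t w 0 0 :=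
      mul_le_mul_of_nonneg_left h2 (by positivity)
    nlinarith
  · simp only [etaPoly, num, den]
    nlinarith

lemma den_pos_of_zetaPoly_nonneg (ht : 2 ≤ t) {w : List ℤ} (hw : ∀ e ∈ w, e ≤ -2) {x : ℝ}
    (hx : -t ≤ x) (h : 0 ≤ zetaPoly t w x) : 0 < den t w x := by
  obtain ⟨h1, h2⟩ := transfer_signs_weak ht hw
  have hdet := num_den_det (t := t) w x
  unfold zetaPoly at h
  by_contra! hd
  nlinarith [mul_nonneg (neg_nonneg.2 h1) h, mul_nonneg (neg_nonneg.2 h1) (by linarith : 0 ≤ x + t),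
    mul_nonneg (mul_nonneg (neg_nonneg.2 h1) (by linarith : 0 ≤ x + t)) (neg_nonneg.2 hd)]

lemma zetaPoly_pos_iff {w : List ℤ} {x : ℝ} (hd : 0 < den t w x) :
    0 < zetaPoly t w x ↔ num t w x / den t w x < x + t := by
  rw [div_lt_iff₀ hd, zetaPoly, sub_pos]

lemma etaPoly_pos_iff (ht : 2 ≤ t) {w : List ℤ} {x : ℝ} (hx : x ≤ 0) (hd : 0 < den t w x) :
    0 < etaPoly t w x ↔ num t w x / den t w x < syncPoint t x := by
  have : 0 < 1 - t * x := by nlinarith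
  rw [syncPoint, div_lt_div_iff₀ hd this, etaPoly, sub_pos, mul_comm (num t w x)]

/-- The synchronization point lies to the left of the right endpoint, so the root of `etaPoly` lies
to the left of the root of `zetaPoly`. -/
lemma zetaPoly_pos_of_etaPoly_eq_zero (ht : 2 ≤ t) {w : List ℤ} (hw : ∀ e ∈ w, e ≤ -2)
    (hne : w ≠ []) {x : ℝ} (hx : -t < x) (hx0 : x < 0) (h : etaPoly t w x = 0) :
    0 < zetaPoly t w x := by
  obtain ⟨h1, h2, -⟩ := transfer_signs ht hw hne
  have hdet := num_den_det (t := t) w x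
  have hs : 0 < 1 - t * x := by nlinarith
  have hp := syncPoint_neg ht hx0
  have hp1 : -1 ≤ syncPoint t x := by
    rw [syncPoint, le_div_iff₀ hs]; nlinarith
  have hN : num t w x = den t w x * syncPoint t x := by
    rw [etaPoly, sub_eq_zero] at h
    rw [syncPoint, mul_div_assoc', eq_div_iff hs.ne']
    linarith
  have hd : 0 < den t w x := by
    rw [hN] at hdet
    -- Here `num = den * syncPoint`, and the cofactor of `den` in the determinant is positive.
    have hfac : den t w x * (transfer t w 0 0 - transfer t w 1 0 * syncPoint t x) = 1 := by
      linarith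
    have hc : 0 ≤ transfer t w 0 0 - transfer t w 1 0 * syncPoint t x := by nlinarith
    by_contra! hd
    linarith [mul_nonpos_of_nonpos_of_nonneg hd hc]
  rw [zetaPoly, hN, mul_comm (x + t), ← mul_sub]
  exact mul_pos hd (by linarith)

/-- A negative left endpoint which is not moved to the left by a digit `e ≤ -2` is at least `-1`. -/
lemma neg_one_le (ht : 2 ≤ t) {e : ℤ} (he : e ≤ -2) {x : ℝ} (hx : -t ≤ x) (hx0 : x < 0)
    (h : x ≤ digitMap t e x) : -1 ≤ x := by
  have he' : (e : ℝ) ≤ -2 := by exact_mod_cast he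
  have h2 : digitMap t e x * x ≤ x * x := mul_le_mul_of_nonpos_right h hx0.le
  have h3 : digitMap t e x * x = x - 1 + e * t * x := by
    have := hx0.ne
    unfold digitMap; field_simp
  have h4 : -2 * (t * x) ≤ e * (t * x) := mul_le_mul_of_nonpos_right he' (by nlinarith)
  by_contra! hlt
  nlinarith

lemma IsNode.letters {e : ℤ} {u p : List ℤ} (hn : IsNode e u p) :
    (∀ x ∈ u, x ≤ e) ∧ ∀ x ∈ p, x ≤ e := by
  induction hn with
  | root => simp
  | child u p j _ ih =>
    obtain ⟨h1, h2⟩ := ih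
    simp only [wpow, List.mem_append, List.mem_flatten, List.mem_replicate, List.mem_singleton]
    constructor
    · rintro x (h | h | rfl)
      exacts [h1 x h, h2 x h, le_rfl]
    · rintro x (⟨w, ⟨-, rfl⟩, hx⟩ | h)
      · simp only [List.mem_append, List.mem_cons] at hx
        rcases hx with h | rfl | h
        exacts [h2 x h, by lia, h1 x h]
      · exact h2 x h

lemma IsNode.letters_child {e : ℤ} {u p : List ℤ} (hn : IsNode e u p) (j : ℕ) :
    ∀ x ∈ u ++ (p ++ [e]) ++ (wpow (p ++ (e - 1) :: u) j ++ p), x ≤ e := by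
  have := (IsNode.child u p j hn).letters
  intro x hx
  rcases List.mem_append.1 hx with h | h
  exacts [this.1 x h, this.2 x h]

/-- At some parameter, the digits of the left endpoint begin with `v` and its orbit after `v` agrees
with its orbit after the parent `u`. For the first child of `v` this is the same parameter as
for `v`, for each further child it is the endpoint `ζ` of the preceding one. -/
lemma IsNode.exists_start {e : ℤ} {u p : List ℤ} (hn : IsNode e u p) (ht : 2 ≤ t) (he : e ≤ -2) :
    ∃ a, -1 ≤ a ∧ Follows t a a (u ++ (p ++ [e])) ∧
      digitOrbit t a (u ++ (p ++ [e])) = digitOrbit t a u := by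
  induction hn with
  | root =>
    have he' : (e : ℝ) ≤ -2 := by exact_mod_cast he
    obtain ⟨a, h1, h2, h3⟩ := exists_root_of_sign_change (q := fun x => -x ^ 2 + (1 + e * t) * x - 1)
      (A := -1) (B := 1 + e * t) (C := -1) (lo := -1) (hi := 0) (fun x => by ring) (by norm_num)
      (by nlinarith) (by norm_num)
    have h4 := (h3 a h1.le h2.le).2.2 rfl
    -- For the root, `u` is empty, and `a` is the fixed point of the digit `e`.
    have hfix : digitMap t e a = a := by
      have := h2.ne
      unfold digitMap
      field_simp
      linarith
    refine ⟨a, h1.le, ?_, ?_⟩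
    · simp only [List.nil_append, follows_singleton, hfix]
      exact ⟨h2, le_rfl, by linarith⟩
    · simp [hfix]
  | child u p j hn ih =>
    set v := u ++ (p ++ [e]) with hv
    set v' := p ++ (e - 1) :: u with hv'
    suffices h : ∀ j, ∃ a, -1 ≤ a ∧ Follows t a a (v ++ (wpow v' j ++ (p ++ [e]))) ∧
        digitOrbit t a (v ++ wpow v' j) = digitOrbit t a u by
      obtain ⟨a, h1, h2, h3⟩ := h j
      refine ⟨a, h1, by simpa using h2, ?_⟩
      have : v ++ (wpow v' j ++ p ++ [e]) = v ++ wpow v' j ++ (p ++ [e]) := by simp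
      rw [this, digitOrbit_append, h3, ← digitOrbit_append]
    intro j
    induction j with
    | zero =>
      obtain ⟨a, h1, h2, h3⟩ := ih
      refine ⟨a, h1, ?_, by simpa using h3⟩
      rw [wpow_zero, List.nil_append, follows_append, h3]
      exact ⟨h2, (follows_append.1 h2).2⟩
    | succ j ihj =>
      obtain ⟨a, h1, h2, -⟩ := ihj
      have hl := hn.letters_child j
      set w := v ++ (wpow v' j ++ p) with hw
      have hl2 : ∀ x ∈ w, x ≤ -2 := fun x hx => (hl x hx).trans he
      have hl3 : ∀ x ∈ w ++ [e], x ≤ -2 := by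
        intro x hx
        rcases List.mem_append.1 hx with h | h
        exacts [hl2 x h, by simp at h; lia]
      have hwe : v ++ (wpow v' j ++ (p ++ [e])) = w ++ [e] := by simp [hw]
      rw [hwe] at h2
      obtain ⟨y, hy, -⟩ := hn.exists_cons
      have ha0 : a < 0 := by
        rw [hw, hv, hy] at h2
        exact h2.1
      obtain ⟨z, z1, z2, z3⟩ := exists_zetaPoly_root ht hl3 (by simp)
      have hz0 := (z3 z z1.le z2.le).2.2 rfl
      have hdz := den_pos_of_zetaPoly_nonneg ht hl3 z1.le hz0.ge
      have h2' := follows_append.1 h2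
      have haz : a ≤ z := by
        obtain ⟨d1, d2⟩ := h2.digitOrbit_eq
        refine ((z3 a (by linarith) ha0.le).1.1 ?_).le
        rw [zetaPoly_pos_iff d1, ← d2, digitOrbit_append]
        exact (follows_singleton.1 h2'.2).2.2
      obtain ⟨hneg, hf⟩ := h2'.1.extend_prefix ht hl2 h1 haz hdz
      have hend : digitMap t e (digitOrbit t z w) = z + t := by
        have := (h2.extend ht hl3 h1 haz hdz).1
        rw [digitOrbit_append] at this
        simp only [digitOrbit_cons, digitOrbit_nil] at this
        rw [this, div_eq_iff hdz.ne']
        rw [zetaPoly] at hz0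
        linarith
      -- At `ζ` the last digit `e` leads to the right endpoint, so `e - 1` leads back to `z` itself,
      -- from where the digits `u` and then `π e` can be followed as from the start.
      have hend' : digitMap t (e - 1) (digitOrbit t z w) = z := by
        rw [digitMap_pred, hend]; ring
      have hfv := (follows_append.1 hf).1
      have hfu := follows_append.1 hfv
      have horb : digitOrbit t z (v ++ wpow v' (j + 1)) = digitOrbit t z u := by
        have : v ++ wpow v' (j + 1) = w ++ ((e - 1) :: u) := by
          rw [wpow_succ', hw, hv']; simp
        rw [this, digitOrbit_append, digitOrbit_cons, hend']
      have hfol : Follows t z z (v ++ wpow v' (j + 1)) := by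
        have : v ++ wpow v' (j + 1) = w ++ ((e - 1) :: u) := by
          rw [wpow_succ', hw, hv']; simp
        rw [this, follows_append, follows_cons, hend']
        exact ⟨hf, hneg, le_rfl, by linarith, hfu.1⟩
      refine ⟨z, h1.trans haz, ?_, horb⟩
      rw [← List.append_assoc, follows_append, horb]
      exact ⟨hfol, hfu.2⟩

/-- The parameters for which the orbit after `v` lies to the right of the synchronization point form
the interval between the roots of the two polynomials. -/
lemma IsNode.sync_iff {e : ℤ} {u p : List ℤ} (hn : IsNode e u p) (ht : 2 ≤ t) (he : e ≤ -2)
    {x : ℝ} (hx : -t ≤ x) (hx0 : x ≤ 0) :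
    (Follows t x x (u ++ (p ++ [e])) ∧ syncPoint t x ≤ digitOrbit t x (u ++ (p ++ [e]))) ↔
      etaPoly t (u ++ (p ++ [e])) x ≤ 0 ∧ 0 < zetaPoly t (u ++ (p ++ [e])) x := by
  set v := u ++ (p ++ [e]) with hv
  have hl : ∀ x ∈ v, x ≤ -2 := by
    intro x hx
    simp only [hv, List.mem_append, List.mem_singleton] at hx
    rcases hx with h | h | rfl
    exacts [(hn.letters.1 x h).trans he, (hn.letters.2 x h).trans he, he]
  have hne : v ≠ [] := by simp [hv]
  have hlast : ∀ y, Follows t y y v → digitOrbit t y v < y + t := by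
    intro y hy
    rw [hv, ← List.append_assoc] at hy ⊢
    rw [digitOrbit_append]
    exact (follows_singleton.1 (follows_append.1 hy).2).2.2
  constructor
  · rintro ⟨h1, h2⟩
    obtain ⟨d1, d2⟩ := h1.digitOrbit_eq
    rw [← not_lt, etaPoly_pos_iff ht hx0 d1, zetaPoly_pos_iff d1, ← d2, not_lt]
    exact ⟨h2, hlast x h1⟩
  · rintro ⟨h1, h2⟩
    obtain ⟨a, a1, a2, a3⟩ := hn.exists_start ht he
    have ha0 : a < 0 := by
      obtain ⟨y, hy, -⟩ := hn.exists_cons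
      rw [hy] at a2
      exact a2.1
    obtain ⟨d1, d2⟩ := a2.digitOrbit_eq
    have hpos : 0 < etaPoly t v a := by
      rw [etaPoly_pos_iff ht ha0.le d1, ← d2, a3]
      exact hn.digitOrbit_parent_lt ht a2
    obtain ⟨r, r1, r2, r3⟩ := exists_etaPoly_root ht hl hne
    have har := (r3 a (by linarith) ha0.le).1.1 hpos
    have hrx : r ≤ x := by
      by_contra! h
      exact absurd ((r3 x hx hx0).1.2 h) (not_lt.2 h1)
    have hd := den_pos_of_zetaPoly_nonneg ht hl hx h2.le
    obtain ⟨e1, e2, e3⟩ := a2.extend ht hl a1 (har.le.trans hrx) hd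
    have hlt : digitOrbit t x v < x + t := by
      rw [e1]; exact (zetaPoly_pos_iff hd).1 h2
    refine ⟨e3 hlt, ?_⟩
    by_contra! hc
    rw [e1, ← etaPoly_pos_iff ht hx0 hd] at hc
    exact absurd hc (not_lt.2 h1)

/-! ### Digits and Möbius transformations -/

lemma mu_eq : mu = 1 := by
  rw [mu, Real.cos_pi_div_three]; norm_num

lemma two_le_tPar {n : ℕ} (hn : 3 ≤ n) : 2 ≤ tPar n := by
  have hn' : (3 : ℝ) ≤ n := by exact_mod_cast hn
  have h : Real.cos (Real.pi / 3) ≤ Real.cos (Real.pi / n) := by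
    apply Real.cos_le_cos_of_nonneg_of_le_pi (by positivity)
    · linarith [Real.pi_pos]
    · exact div_le_div_of_nonneg_left Real.pi_pos.le (by norm_num) hn'
  rw [Real.cos_pi_div_three] at h
  rw [tPar, mu_eq]
  linarith

lemma r0_eq (n : ℕ) (α : ℝ) : r0 n α = ell0 n α + tPar n := by
  unfold r0 ell0; ring

lemma coe_matC : (matC : Matrix (Fin 2) (Fin 2) ℝ) = !![-1, 1; -1, 0] := by
  simp [matC, Matrix.GeneralLinearGroup.mkOfDetNeZero, mu_eq]

lemma coe_matA (n : ℕ) : (matA n : Matrix (Fin 2) (Fin 2) ℝ) = !![1, tPar n; 0, 1] := by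
  simp [matA, Matrix.GeneralLinearGroup.mkOfDetNeZero]

lemma coe_matA_inv (n : ℕ) :
    ((matA n)⁻¹ : GL (Fin 2) ℝ) = (!![1, -tPar n; 0, 1] : Matrix (Fin 2) (Fin 2) ℝ) := by
  rw [Matrix.coe_units_inv, coe_matA, Matrix.inv_def]
  simp [Matrix.det_fin_two_of, Matrix.adjugate_fin_two_of]

lemma coe_matA_zpow (n : ℕ) (d : ℤ) :
    ((matA n ^ d : GL (Fin 2) ℝ) : Matrix (Fin 2) (Fin 2) ℝ) = !![1, d * tPar n; 0, 1] := by
  induction d using Int.induction_on with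
  | zero => simp [Matrix.one_fin_two]
  | succ i ih =>
    rw [zpow_add_one, Units.val_mul, ih, coe_matA, Matrix.mul_fin_two]
    push_cast
    congr 1; ring_nf
  | pred i ih =>
    rw [zpow_sub_one, Units.val_mul, ih, coe_matA_inv, Matrix.mul_fin_two]
    push_cast
    congr 1; ring_nf

lemma smul_coe_eq_coe_iff {g : GL (Fin 2) ℝ} {x y : ℝ} :
    g • (x : OnePoint ℝ) = (y : OnePoint ℝ) ↔
      g 1 0 * x + g 1 1 ≠ 0 ∧ g 0 0 * x + g 0 1 = y * (g 1 0 * x + g 1 1) := by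
  rw [OnePoint.smul_some_eq_ite]
  split_ifs with h
  · simp [h]
  · rw [OnePoint.coe_eq_coe, div_eq_iff h]
    simp [h]

lemma matC_smul_eq_coe_iff {x y : ℝ} :
    matC • (x : OnePoint ℝ) = (y : OnePoint ℝ) ↔ x ≠ 0 ∧ y = 1 - 1 / x := by
  rw [smul_coe_eq_coe_iff, coe_matC]
  simp only [Matrix.of_apply, Matrix.cons_val', Matrix.cons_val_zero, Matrix.cons_val_one,
    Matrix.cons_val_fin_one]
  constructor
  · rintro ⟨h1, h2⟩
    have h : x ≠ 0 := by simpa using h1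
    refine ⟨h, ?_⟩
    field_simp
    linarith
  · rintro ⟨h1, rfl⟩
    refine ⟨by simpa using h1, ?_⟩
    field_simp
    ring

lemma matA_zpow_smul (n : ℕ) (d : ℤ) (x : ℝ) :
    matA n ^ d • (x : OnePoint ℝ) = ((x + d * tPar n : ℝ) : OnePoint ℝ) := by
  rw [smul_coe_eq_coe_iff, coe_matA_zpow]
  simp

lemma coe_mem_interval {n : ℕ} {α x : ℝ} :
    (x : OnePoint ℝ) ∈ interval n α ↔ ell0 n α ≤ x ∧ x < ell0 n α + tPar n := by
  rw [interval, ← r0_eq]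
  simp

lemma HasDigit.unique {n : ℕ} {α x : ℝ} {k k' : ℤ} {l l' : ℕ} (h : HasDigit n α x k l)
    (h' : HasDigit n α x k' l') : k = k' ∧ l = l' := by
  obtain ⟨h1, h2, h3, z, h4, h5⟩ := h
  obtain ⟨h1', h2', h3', z', h4', h5'⟩ := h'
  obtain rfl : l = l' := by
    rcases lt_trichotomy l l' with h | h | h
    · exact absurd (h3' l h1 h) h2
    · exact h
    · exact absurd (h3 l' h1' h) h2'
  rw [h4, OnePoint.coe_eq_coe] at h4'
  exact ⟨by rw [h5, h5', h4'], rfl⟩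

/-- A point of the interval has the digit `(e, 1)` with `e ≤ -2` exactly if it is negative and the
corresponding digit map sends it into the interval. -/
lemma hasDigit_one_iff {n : ℕ} (ht : 2 ≤ tPar n) {α y : ℝ} (hα : α ∈ Icc (0 : ℝ) 1)
    (hy : y < ell0 n α + tPar n) {e : ℤ} (he : e ≤ -2) :
    HasDigit n α y e 1 ↔ y < 0 ∧ ell0 n α ≤ digitMap (tPar n) e y ∧
      digitMap (tPar n) e y < ell0 n α + tPar n := by
  have ht0 : 0 < tPar n := by linarith
  have he' : (e : ℝ) ≤ -2 := by exact_mod_cast he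
  have hℓ : -tPar n ≤ ell0 n α ∧ ell0 n α ≤ 0 := by
    unfold ell0; constructor <;> nlinarith [hα.1, hα.2]
  have hfloor : ∀ z : ℝ, e = -⌊z / tPar n + 1 - α⌋ ↔
      ell0 n α ≤ z + e * tPar n ∧ z + e * tPar n < ell0 n α + tPar n := by
    intro z
    rw [eq_comm, neg_eq_iff_eq_neg, Int.floor_eq_iff]
    have hz : z / tPar n * tPar n = z := div_mul_cancel₀ _ ht0.ne'
    push_cast
    rw [← mul_le_mul_iff_left₀ ht0, ← mul_lt_mul_iff_left₀ ht0, ell0]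
    constructor <;> rintro ⟨h1, h2⟩ <;> constructor <;> nlinarith
  constructor
  · rintro ⟨-, -, -, z, hz, hk⟩
    rw [pow_one, matC_smul_eq_coe_iff] at hz
    obtain ⟨h0, rfl⟩ := hz
    have hk' := (hfloor _).1 hk
    refine ⟨?_, hk'⟩
    by_contra! hneg
    have : 0 ≤ 1 / y := by positivity
    nlinarith [hk'.1]
  · rintro ⟨h0, h1⟩
    have hz : matC • (y : OnePoint ℝ) = ((1 - 1 / y : ℝ) : OnePoint ℝ) :=
      matC_smul_eq_coe_iff.2 ⟨h0.ne, rfl⟩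
    refine ⟨le_rfl, ?_, fun j h1 h2 => absurd h1 (by lia), _, by rw [pow_one, hz],
      (hfloor _).2 h1⟩
    rw [pow_one, hz, coe_mem_interval]
    rintro ⟨-, h3⟩
    have h4 := h1.1
    unfold digitMap at h4
    nlinarith

lemma digitsBegin_iff {n : ℕ} (ht : 2 ≤ tPar n) {α : ℝ} (hα : α ∈ Icc (0 : ℝ) 1)
    {w : List ℤ} (hw : ∀ e ∈ w, e ≤ -2) {y : ℝ} (hy : y < ell0 n α + tPar n) :
    DigitsBegin n α y w ↔ Follows (tPar n) (ell0 n α) y w := by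
  induction w generalizing y with
  | nil => simp [DigitsBegin]
  | cons e w ih =>
    have he := hw e (by simp)
    have ih' := @ih (fun e he => hw e (by simp [he]))
    rw [DigitsBegin, follows_cons, hasDigit_one_iff ht hα hy he]
    have hmap : ∀ {y' : ℝ}, HasDigit n α y e 1 → y < 0 →
        (MapsTo n α y y' ↔ y' = digitMap (tPar n) e y) := by
      intro y' hd hneg
      have himg : matA n ^ e • matC ^ 1 • (y : OnePoint ℝ) =
          ((digitMap (tPar n) e y : ℝ) : OnePoint ℝ) := by
        rw [pow_one, matC_smul_eq_coe_iff.2 ⟨hneg.ne, rfl⟩, matA_zpow_smul, digitMap]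
      constructor
      · rintro ⟨k, l, h1, h2⟩
        obtain ⟨rfl, rfl⟩ := hd.unique h1
        rw [himg, OnePoint.coe_eq_coe] at h2
        exact h2.symm
      · rintro rfl
        exact ⟨e, 1, hd, himg⟩
    constructor
    · rintro ⟨h, y', h1, h2⟩
      have hd := (hasDigit_one_iff ht hα hy he).2 h
      rw [hmap hd h.1] at h1
      subst h1
      exact ⟨h.1, h.2.1, h.2.2, (ih' h.2.2).1 h2⟩
    · rintro ⟨h1, h2, h3, h4⟩
      have hd := (hasDigit_one_iff ht hα hy he).2 ⟨h1, h2, h3⟩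
      exact ⟨⟨h1, h2, h3⟩, _, (hmap hd h1).2 rfl, (ih' h3).2 h4⟩

lemma coe_leftMatrix_mul (n k : ℕ) (v : List ℕ) :
    ((leftMatrix n k v * matA n : GL (Fin 2) ℝ) : Matrix (Fin 2) (Fin 2) ℝ) =
      transfer (tPar n) (lowerDigits k v) := by
  have key : ∀ (w : List ℤ) (M : GL (Fin 2) ℝ) (N : Matrix (Fin 2) (Fin 2) ℝ),
      ((M * matA n : GL (Fin 2) ℝ) : Matrix (Fin 2) (Fin 2) ℝ) = N →
      ((w.foldl (fun M d => matA n ^ d * matC * M) M * matA n : GL (Fin 2) ℝ) :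
        Matrix (Fin 2) (Fin 2) ℝ) =
      w.foldl (fun M (e : ℤ) => !![-(1 + e * tPar n), 1; -1, 0] * M) N := by
    intro w
    induction w with
    | nil => intro M N h; exact h
    | cons e w ih =>
      intro M N h
      rw [List.foldl_cons, List.foldl_cons]
      apply ih
      rw [mul_assoc, Units.val_mul, h, Units.val_mul, coe_matA_zpow, coe_matC, Matrix.mul_fin_two]
      congr 1
      ext i j
      fin_cases i <;> fin_cases j <;> simp
      ring
  rw [leftMatrix, transfer]
  exact key (lowerDigits k v) (matA n)⁻¹ 1 (by rw [inv_mul_cancel, Units.val_one])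

lemma isZeta_iff {n k : ℕ} {v : List ℕ} {ζ : ℝ} :
    IsZeta n k v ζ ↔ ζ ∈ Icc (0 : ℝ) 1 ∧
      zetaPoly (tPar n) (lowerDigits k v) (ell0 n ζ) = 0 := by
  rw [IsZeta, smul_coe_eq_coe_iff, coe_leftMatrix_mul, r0_eq]
  have := num_den_det (t := tPar n) (lowerDigits k v) (ell0 n ζ)
  change _ ∧ den (tPar n) (lowerDigits k v) (ell0 n ζ) ≠ 0 ∧
    num (tPar n) (lowerDigits k v) (ell0 n ζ) = _ * den (tPar n) (lowerDigits k v) (ell0 n ζ) ↔ _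
  rw [zetaPoly, sub_eq_zero, and_congr_right_iff]
  refine fun _ => ⟨fun h => h.2.symm, fun h => ⟨fun h0 => ?_, h.symm⟩⟩
  rw [h0, mul_zero] at h
  simp [h0, ← h] at this

lemma isEta_iff {n k : ℕ} (ht : 2 ≤ tPar n) {v : List ℕ} {η : ℝ} :
    IsEta n k v η ↔ η ∈ Icc (0 : ℝ) 1 ∧
      etaPoly (tPar n) (lowerDigits k v) (ell0 n η) = 0 := by
  rw [IsEta, and_congr_right_iff]
  intro hη
  have hx : ell0 n η ≤ 0 := by unfold ell0; nlinarith [hη.2]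
  have hp : 0 < 1 - tPar n * ell0 n η := by nlinarith
  have hA : (r0 n η : OnePoint ℝ) = matA n • (ell0 n η : OnePoint ℝ) := by
    rw [← zpow_one (matA n), matA_zpow_smul, r0_eq]
    simp
  have hM : ((matC * (matC * (matA n)⁻¹ * matC) : GL (Fin 2) ℝ) : Matrix (Fin 2) (Fin 2) ℝ) =
      !![1, 0; tPar n, 1] := by
    simp only [Units.val_mul, coe_matC, coe_matA_inv, Matrix.mul_fin_two]
    congr 1
    ext i j
    fin_cases i <;> fin_cases j <;> simp
  -- The transformation `C² A⁻¹ C` maps the synchronization point to the left endpoint.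
  have hs : (matC * (matC * (matA n)⁻¹ * matC)) • (syncPoint (tPar n) (ell0 n η) : OnePoint ℝ) =
      (ell0 n η : OnePoint ℝ) := by
    rw [smul_coe_eq_coe_iff, hM]
    simp only [Matrix.of_apply, Matrix.cons_val', Matrix.cons_val_zero, Matrix.cons_val_one,
      Matrix.cons_val_fin_one, syncPoint]
    have : tPar n * (ell0 n η / (1 - tPar n * ell0 n η)) + 1 = 1 / (1 - tPar n * ell0 n η) := by
      field_simp
      ring
    rw [this]
    exact ⟨(one_div_pos.2 hp).ne', by field_simp; ring⟩
  rw [eq_inv_smul_iff, hA, smul_smul, smul_smul]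
  nth_rewrite 2 [← hs]
  rw [show matC * (matC * (matA n)⁻¹ * matC * leftMatrix n k v) * matA n =
    matC * (matC * (matA n)⁻¹ * matC) * (leftMatrix n k v * matA n) by group,
    mul_smul, smul_left_cancel_iff, smul_coe_eq_coe_iff, coe_leftMatrix_mul]
  have := num_den_det (t := tPar n) (lowerDigits k v) (ell0 n η)
  change den (tPar n) (lowerDigits k v) (ell0 n η) ≠ 0 ∧
    num (tPar n) (lowerDigits k v) (ell0 n η) = _ * den (tPar n) (lowerDigits k v) (ell0 n η) ↔ _
  rw [etaPoly, syncPoint, sub_eq_zero, div_mul_eq_mul_div, eq_div_iff hp.ne']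
  refine ⟨fun h => by rw [← h.2]; ring, fun h => ⟨fun h0 => ?_, by rw [h]; ring⟩⟩
  rw [h0, mul_zero, eq_comm, mul_eq_zero, or_iff_right hp.ne'] at h
  simp [h0, h] at this

lemma isEpsilon_iff {n : ℕ} {ε : ℝ} :
    IsEpsilon n ε ↔ ε ∈ Icc (0 : ℝ) 1 ∧ zetaPoly (tPar n) [-1] (ell0 n ε) = 0 := by
  have hM : (((matA n)⁻¹ * matC : GL (Fin 2) ℝ) : Matrix (Fin 2) (Fin 2) ℝ) =
      transfer (tPar n) [-1] := by
    rw [Units.val_mul, coe_matA_inv, coe_matC, transfer]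
    simp
    ring
  rw [IsEpsilon, smul_coe_eq_coe_iff, hM, r0_eq]
  have := num_den_det (t := tPar n) [-1] (ell0 n ε)
  change _ ∧ den (tPar n) [-1] (ell0 n ε) ≠ 0 ∧
    num (tPar n) [-1] (ell0 n ε) = _ * den (tPar n) [-1] (ell0 n ε) ↔ _
  rw [zetaPoly, sub_eq_zero, and_congr_right_iff]
  refine fun _ => ⟨fun h => h.2.symm, fun h => ⟨fun h0 => ?_, h.symm⟩⟩
  rw [h0, mul_zero] at h
  simp [h0, ← h] at this

/-! ### Words of the tree as digit sequences -/

/-- The sequence with blocks of the letters `x`, `y`, `x`, `y`, … of the given lengths. -/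
def blocks (x y : ℤ) : List ℕ → List ℤ
  | [] => []
  | c :: v => List.replicate c x ++ blocks y x v

lemma lowerDigits_eq_blocks (k : ℕ) : ∀ v, lowerDigits k v = blocks (-(k : ℤ)) (-(k : ℤ) - 1) v
  | [] => rfl
  | [c] => by simp [lowerDigits, blocks]
  | c :: d :: v => by simp [lowerDigits, blocks, lowerDigits_eq_blocks k v]

lemma blocks_append_of_even {x y : ℤ} {v : List ℕ} (w : List ℕ) (h : Even v.length) :
    blocks x y (v ++ w) = blocks x y v ++ blocks x y w := by
  induction v using List.twoStepInduction with
  | nil => rfl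
  | singleton c => simp at h
  | cons_cons c d v ih _ =>
    have : Even v.length := by
      simpa [Nat.even_add_one] using h
    simp [blocks, ih this]

lemma blocks_append_of_odd {x y : ℤ} {v : List ℕ} (w : List ℕ) (h : Odd v.length) :
    blocks x y (v ++ w) = blocks x y v ++ blocks y x w := by
  cases v with
  | nil => simp at h
  | cons c v =>
    have : Even v.length := by simpa [Nat.odd_add_one] using h
    simp [blocks, blocks_append_of_even w this]

lemma even_length_flatten {v : List ℕ} (h : Even v.length) (j : ℕ) :
    Even (List.replicate j v).flatten.length := by
  simpa using h.mul_left j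

lemma blocks_flatten {x y : ℤ} {v : List ℕ} (h : Even v.length) (j : ℕ) :
    blocks x y (List.replicate j v).flatten = wpow (blocks x y v) j := by
  induction j with
  | zero => rfl
  | succ j ih =>
    rw [List.replicate_succ, List.flatten_cons, blocks_append_of_even _ h, ih, wpow_succ]

lemma wpow_add (w : List ℤ) (i j : ℕ) : wpow w (i + j) = wpow w i ++ wpow w j := by
  rw [wpow, List.replicate_add, List.flatten_append, wpow, wpow]

lemma wpow_one (w : List ℤ) : wpow w 1 = w := by simp [wpow]

/-- Read as digits from an upper block on, `v'` is `v` with its first digit `e` replaced by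
`e - 1`. -/
lemma blocks_wordPrime (e : ℤ) {w : List ℕ} (hodd : Odd w.length) (hpos : 1 ≤ w.headI) :
    ∃ y, blocks e (e - 1) w = e :: y ∧ blocks (e - 1) e (wordPrime w) = (e - 1) :: y := by
  match w, hodd, hpos with
  | [1], _, _ => exact ⟨[], by simp [blocks, wordPrime]⟩
  | 1 :: d :: v, _, _ =>
    exact ⟨blocks (e - 1) e (d :: v), by simp [blocks, wordPrime, List.replicate_succ]⟩
  | (c + 2) :: v, _, _ =>
    exact ⟨List.replicate (c + 1) e ++ blocks (e - 1) e v, by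
      simp [blocks, wordPrime, List.replicate_succ]⟩

lemma even_length_wordPrime {w : List ℕ} (hodd : Odd w.length) (hpos : 1 ≤ w.headI)
    (hne : w ≠ [1]) : Even (wordPrime w).length := by
  match w, hodd, hpos, hne with
  | 1 :: d :: v, h, _, _ => simpa [wordPrime, Nat.odd_add_one, Nat.even_add_one] using h
  | (c + 2) :: v, h, _, _ => simpa [wordPrime, Nat.odd_add_one, Nat.even_add_one] using h

/-- The exponent `j` for which the digits of `Θ_q(v)` are `v v' ⋯ v' π e` with `j` factors `v'`.
It is `q`, except for one-letter words `c > 1`, where `v''` begins with a factor `v'`, and except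
that `Θ_{-1}(1)` takes the place of `Θ_0(1)`. -/
def childIndex (v : Vertex) (q : ℤ) : ℕ :=
  if v.word.length = 1 ∧ v.word ≠ [1] then (q + 1).toNat else q.toNat

lemma childIndex_injOn (v : Vertex) : InjOn (childIndex v) (thetaIndices v) := by
  intro q hq q' hq' h
  simp only [thetaIndices, mem_ofPred_eq] at hq hq'
  unfold childIndex at h
  by_cases h1 : v.word = [1] <;> by_cases h2 : v.word.length = 1 <;> simp_all <;> lia

lemma childIndex_surjOn (v : Vertex) (j : ℕ) : ∃ q ∈ thetaIndices v, childIndex v q = j := by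
  simp only [thetaIndices, mem_ofPred_eq, childIndex]
  by_cases h1 : v.word = [1]
  · rcases Nat.eq_zero_or_pos j with rfl | h
    · exact ⟨-1, by simp [h1]⟩
    · exact ⟨j, by simp [h1]; lia⟩
  · by_cases h2 : v.word.length = 1
    · exact ⟨j - 1, by simp [h1, h2]; lia⟩
    · exact ⟨j, by simp [h1, h2]⟩

/-- The vertex `v` of the tree of words in natural numbers corresponds to the node `(u, p)`: its
digits are `u p e`, and its second entry `v''`, read from an upper block on, has the digits `p e`,
preceded by one factor `v'` if `v` is a one-letter word `c > 1`. -/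
structure Represents (e : ℤ) (v : Vertex) (u p : List ℤ) : Prop where
  isNode : IsNode e u p
  odd : Odd v.word.length
  pos : 1 ≤ v.word.headI
  word : blocks e (e - 1) v.word = u ++ (p ++ [e])
  suffix_nil : v.word.length = 1 → p = []
  even : v.word ≠ [1] → Even v.tail.length
  tail : v.word ≠ [1] → blocks (e - 1) e v.tail =
    wpow (p ++ (e - 1) :: u) (if v.word.length = 1 then 1 else 0) ++ (p ++ [e])

lemma Represents.root (e : ℤ) : Represents e ⟨[1], []⟩ [] [] where
  isNode := .root
  odd := by simp
  pos := by simp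
  word := by simp [blocks]
  suffix_nil _ := rfl
  even h := absurd rfl h
  tail h := absurd rfl h

lemma Represents.child {e : ℤ} {v : Vertex} {u p : List ℤ} (h : Represents e v u p) {q : ℤ}
    (hq : q ∈ thetaIndices v) :
    Represents e (Theta q v) (u ++ (p ++ [e]))
      (wpow (p ++ (e - 1) :: u) (childIndex v q) ++ p) := by
  have hnode := IsNode.child u p (childIndex v q) h.isNode
  obtain ⟨hn, hodd, hpos, hword, hnil, heven, htail⟩ := h
  obtain ⟨word, tail⟩ := v
  simp only [thetaIndices, mem_ofPred_eq] at hq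
  simp only at hodd hpos hword hnil heven htail hq
  by_cases h1 : word.length = 1 ∧ q = -1
  · obtain ⟨h1, rfl⟩ := h1
    obtain ⟨c, rfl⟩ := List.length_eq_one_iff.1 h1
    obtain rfl := hnil h1
    have hidx : childIndex ⟨[c], tail⟩ (-1) = 0 := by simp [childIndex]
    simp only [blocks, List.append_nil, List.nil_append] at hword
    simp only [hidx, wpow_zero, List.append_nil, List.nil_append, ← hword] at hnode ⊢
    refine ⟨hnode, ?_, ?_, ?_, ?_, ?_, ?_⟩ <;>
      simp [Theta, blocks, List.replicate_succ', wpow_one]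
  · by_cases h2 : word = [1]
    · subst h2
      obtain rfl := hnil rfl
      have hq' : 0 < q := by simp at hq h1; lia
      obtain ⟨j, rfl⟩ := Int.eq_ofNat_of_zero_le hq'.le
      have hu : u = [] := by simpa [blocks] using hword
      subst hu
      have hidx : childIndex ⟨[1], tail⟩ (j : ℤ) = j := by simp [childIndex]
      have hT : Theta (j : ℤ) ⟨[1], tail⟩ = ⟨[1, j, 1], [j, 1]⟩ := by
        rw [Theta, if_neg h1]; simp
      have hw : wpow [e - 1] j = List.replicate j (e - 1) := by
        simp [wpow, List.flatten_replicate_singleton]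
      simp only [hidx, List.nil_append, List.append_nil, hw] at hnode ⊢
      rw [hT]
      refine ⟨hnode, ?_, ?_, ?_, ?_, ?_, ?_⟩ <;> simp [blocks]
      decide
    · have hq' : 0 ≤ q := by
        have := hq.1
        split_ifs at this with h3
        · have : q ≠ -1 := fun h => h1 ⟨h3, h⟩
          lia
        · exact this
      obtain ⟨j, rfl⟩ := Int.eq_ofNat_of_zero_le hq'
      have hT : Theta (j : ℤ) ⟨word, tail⟩ =
          ⟨word ++ ((List.replicate j (wordPrime word)).flatten ++ tail),
            (List.replicate j (wordPrime word)).flatten ++ tail⟩ := by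
        rw [Theta, if_neg h1, if_neg h2]; simp
      have hidx : childIndex ⟨word, tail⟩ (j : ℤ) = j + if word.length = 1 then 1 else 0 := by
        unfold childIndex
        split_ifs <;> simp_all
      have hev := even_length_wordPrime hodd hpos h2
      have hev2 := (even_length_flatten hev j)
      have hprime : blocks (e - 1) e (wordPrime word) = p ++ (e - 1) :: u := by
        obtain ⟨y, y1, y2⟩ := hn.exists_cons
        obtain ⟨z, z1, z2⟩ := blocks_wordPrime e hodd hpos
        rw [hword, y1, List.cons.injEq] at z1
        rw [z2, y2, z1.2]
      have hcode : blocks (e - 1) e ((List.replicate j (wordPrime word)).flatten ++ tail) =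
          wpow (p ++ (e - 1) :: u) (childIndex ⟨word, tail⟩ (j : ℤ)) ++ (p ++ [e]) := by
        rw [blocks_append_of_even _ hev2, blocks_flatten hev, hprime, htail h2, hidx, wpow_add,
          List.append_assoc]
      have hevT : Even ((List.replicate j (wordPrime word)).flatten ++ tail).length := by
        rw [List.length_append]; exact hev2.add (heven h2)
      set s := (List.replicate j (wordPrime word)).flatten ++ tail
      have hs : s ≠ [] := by
        rintro h
        rw [h] at hcode
        simp [blocks] at hcode
      have hlen : (word ++ s).length ≠ 1 := by
        have h3 := hodd.pos
        have h4 := List.length_pos_iff.2 hs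
        rw [List.length_append]; lia
      rw [hT]
      refine ⟨hnode, ?_, ?_, ?_, fun h => absurd h hlen, fun _ => hevT, fun _ => ?_⟩
      · simp only [List.length_append] at hevT ⊢
        exact hodd.add_even hevT
      · cases word with
        | nil => simp at hodd
        | cons c w => simpa using hpos
      · simp only
        rw [blocks_append_of_odd _ hodd, hcode, hword]
        simp
      · simp only [if_neg hlen]
        rw [hcode]
        simp

lemma InTree.exists_represents {v : Vertex} (h : InTree v) (e : ℤ) :
    ∃ u p, Represents e v u p := by
  induction h with
  | root => exact ⟨_, _, .root e⟩
  | child v q _ hq ih =>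
    obtain ⟨u, p, h⟩ := ih
    exact ⟨_, _, h.child hq⟩

/-! ### Cylinders and the decomposition -/

lemma lowerDigits_le {k : ℕ} (hk : 2 ≤ k) (v : List ℕ) : ∀ e ∈ lowerDigits k v, e ≤ -2 := by
  have key : ∀ (v : List ℕ) (x y : ℤ), x ≤ -2 → y ≤ -2 → ∀ e ∈ blocks x y v, e ≤ -2 := by
    intro v
    induction v with
    | nil => simp [blocks]
    | cons c v ih =>
      intro x y hx hy e he
      simp only [blocks, List.mem_append, List.mem_replicate] at he
      rcases he with ⟨-, rfl⟩ | h
      exacts [hx, ih y x hy hx e h]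
  rw [lowerDigits_eq_blocks]
  exact key v _ _ (by lia) (by lia)

lemma mem_cylinder_iff {n k : ℕ} (ht : 2 ≤ tPar n) (hk : 2 ≤ k) {v : List ℕ} {α : ℝ} :
    α ∈ cylinder n k v ↔ α ∈ Icc (0 : ℝ) 1 ∧
      Follows (tPar n) (ell0 n α) (ell0 n α) (lowerDigits k v) := by
  unfold cylinder
  rw [mem_ofPred_eq, and_congr_right_iff]
  exact fun hα => digitsBegin_iff ht hα (lowerDigits_le hk v) (by linarith)

lemma ell0_mem {n : ℕ} (ht : 2 ≤ tPar n) {α : ℝ} (hα : α ∈ Icc (0 : ℝ) 1) :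
    -tPar n ≤ ell0 n α ∧ ell0 n α ≤ 0 := by
  unfold ell0; constructor <;> nlinarith [hα.1, hα.2]

lemma ell0_lt_iff {n : ℕ} (ht : 2 ≤ tPar n) {α β : ℝ} : ell0 n α < ell0 n β ↔ α < β := by
  rw [ell0, ell0, mul_lt_mul_iff_left₀ (by linarith), sub_lt_sub_iff_right]

/-- An equation with a unique solution `ℓ₀` in `[-t, 0]` has a unique solution `α` in `[0, 1]`. -/
lemma existsUnique_param {n : ℕ} (ht : 2 ≤ tPar n) {q : ℝ → ℝ} {r : ℝ} (h1 : -tPar n < r)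
    (h2 : r < 0) (h : ∀ x, -tPar n ≤ x → x ≤ 0 → (0 < q x ↔ x < r) ∧ (q x = 0 ↔ x = r)) :
    ∃! α : ℝ, α ∈ Icc (0 : ℝ) 1 ∧ q (ell0 n α) = 0 := by
  have ht0 : 0 < tPar n := by linarith
  have hr : ell0 n (1 + r / tPar n) = r := by
    unfold ell0; field_simp; ring
  refine ⟨1 + r / tPar n, ⟨⟨?_, ?_⟩, ?_⟩, ?_⟩
  · have : -1 ≤ r / tPar n := by rw [le_div_iff₀ ht0]; linarith
    linarith
  · have : r / tPar n ≤ 0 := div_nonpos_of_nonpos_of_nonneg h2.le ht0.le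
    linarith
  · simp only [hr]
    exact (h r h1.le h2.le).2.2 rfl
  · rintro β ⟨hβ, hβ0⟩
    obtain ⟨b1, b2⟩ := ell0_mem ht hβ
    have := (h _ b1 b2).2.1 hβ0
    rw [← this, ell0]
    field_simp
    ring

/-- If the equation `q (ℓ₀ (α)) = 0` holds at `β`, then `q` is positive exactly to the left. -/
lemma pos_iff_lt_param {n : ℕ} (ht : 2 ≤ tPar n) {q : ℝ → ℝ} {r : ℝ}
    (h : ∀ x, -tPar n ≤ x → x ≤ 0 → (0 < q x ↔ x < r) ∧ (q x = 0 ↔ x = r)) {α β : ℝ}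
    (hα : α ∈ Icc (0 : ℝ) 1) (hβ : β ∈ Icc (0 : ℝ) 1) (hq : q (ell0 n β) = 0) :
    0 < q (ell0 n α) ↔ α < β := by
  obtain ⟨a1, a2⟩ := ell0_mem ht hα
  obtain ⟨b1, b2⟩ := ell0_mem ht hβ
  rw [(h _ a1 a2).1, ← (h _ b1 b2).2.1 hq, ell0_lt_iff ht]

lemma exists_epsilon_root {t : ℝ} (ht : 2 ≤ t) :
    ∃ r, -t < r ∧ r < 0 ∧ ∀ x, -t ≤ x → x ≤ 0 →
      (0 < zetaPoly t [-1] x ↔ x < r) ∧ (zetaPoly t [-1] x = 0 ↔ x = r) := by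
  have h : ∀ x, zetaPoly t [-1] x = -1 * x ^ 2 + (1 - 2 * t) * x + -1 := by
    intro x
    rw [zetaPoly, ← List.nil_append [-1], num_append, den_append, num_nil, den_nil]
    push_cast; ring
  refine exists_root_of_sign_change h (by linarith) ?_ ?_ <;> rw [h] <;> nlinarith

lemma zetaPoly_neg_one_nonpos_iff {t x : ℝ} (hx : x < 0) :
    zetaPoly t [-1] x ≤ 0 ↔ x + t ≤ digitMap t (-1) x := by
  have h : zetaPoly t [-1] x = -x * (x + t - digitMap t (-1) x) := by
    rw [zetaPoly, ← List.nil_append [-1], num_append, den_append, num_nil, den_nil, digitMap]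
    have := hx.ne
    field_simp
    push_cast; ring
  rw [h, ← sub_nonpos (a := x + t)]
  constructor <;> intro h' <;> nlinarith

lemma lowerDigits_one (k : ℕ) : lowerDigits k [1] = [-(k : ℤ)] := by simp [lowerDigits]

lemma Ico_epsilon_eq {n : ℕ} (ht : 2 ≤ tPar n) {ε : ℝ} (hε : IsEpsilon n ε) :
    Ico ε 1 = ⋃ k ∈ {k : ℕ | 2 ≤ k}, cylinder n k [1] := by
  have ht0 : 0 < tPar n := by linarith
  obtain ⟨hε1, hε2⟩ := isEpsilon_iff.1 hε
  obtain ⟨r, -, -, hr⟩ := exists_epsilon_root ht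
  ext α
  simp only [mem_iUnion, mem_ofPred_eq, exists_prop]
  constructor
  · rintro ⟨h1, h2⟩
    have hα : α ∈ Icc (0 : ℝ) 1 := ⟨hε1.1.trans h1, h2.le⟩
    have hneg : ell0 n α < 0 := by unfold ell0; nlinarith
    have hge : ell0 n α + tPar n ≤ digitMap (tPar n) (-1) (ell0 n α) := by
      rw [← zetaPoly_neg_one_nonpos_iff hneg, ← not_lt, pos_iff_lt_param ht hr hα hε1 hε2]
      exact not_lt.2 h1
    set x := ell0 n α
    set m := ⌊(1 - 1 / x - x) / tPar n⌋ with hm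
    have hm1 : (m : ℝ) * tPar n ≤ 1 - 1 / x - x := by
      rw [← le_div_iff₀ ht0]; exact Int.floor_le _
    have hm2 : 1 - 1 / x - x < (m + 1) * tPar n := by
      rw [← div_lt_iff₀ ht0]; exact Int.lt_floor_add_one _
    have hm3 : 2 ≤ m := by
      rw [hm, Int.le_floor, le_div_iff₀ ht0]
      unfold digitMap at hge
      push_cast at hge ⊢
      linarith
    obtain ⟨k, hkm⟩ := Int.eq_ofNat_of_zero_le (by lia : 0 ≤ m)
    rw [hkm] at hm1 hm2
    have hk : 2 ≤ k := by lia
    refine ⟨k, hk, (mem_cylinder_iff ht hk).2 ⟨hα, ?_⟩⟩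
    rw [lowerDigits_one, follows_singleton, digitMap]
    push_cast at hm1 hm2 ⊢
    exact ⟨hneg, by linarith, by linarith⟩
  · rintro ⟨k, hk, h⟩
    rw [mem_cylinder_iff ht hk, lowerDigits_one, follows_singleton] at h
    obtain ⟨hα, hneg, h1, -⟩ := h
    constructor
    · rw [← not_lt, ← pos_iff_lt_param ht hr hα hε1 hε2, not_lt, zetaPoly_neg_one_nonpos_iff hneg]
      have hk' : (2 : ℝ) ≤ k := by exact_mod_cast hk
      unfold digitMap at h1 ⊢
      push_cast at h1 ⊢
      nlinarith
    · unfold ell0 at hneg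
      nlinarith

lemma pairwiseDisjoint_cylinder (n : ℕ) :
    {k : ℕ | 2 ≤ k}.PairwiseDisjoint (fun k => cylinder n k [1]) := by
  intro k _ k' _ hne
  refine Set.disjoint_left.2 fun α h h' => hne ?_
  have h1 := h.2
  have h2 := h'.2
  rw [lowerDigits_one, DigitsBegin] at h1 h2
  have := (h1.1.unique h2.1).1
  lia

end AlphaCF

theorem mainTheorem6 (n : ℕ) (hn : 3 ≤ n) :
    (∃! ε : ℝ, AlphaCF.IsEpsilon n ε) ∧
    (∀ ε : ℝ, AlphaCF.IsEpsilon n ε →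
      Set.Ico ε 1 = ⋃ k ∈ {k : ℕ | 2 ≤ k}, AlphaCF.cylinder n k [1]) ∧
    {k : ℕ | 2 ≤ k}.PairwiseDisjoint (fun k => AlphaCF.cylinder n k [1]) ∧
    ∀ k : ℕ, 2 ≤ k → ∀ v : AlphaCF.Vertex, AlphaCF.InTree v →
      (∃! η : ℝ, AlphaCF.IsEta n k v.word η) ∧
      (∃! ζ : ℝ, AlphaCF.IsZeta n k v.word ζ) ∧
      ∀ η ζ : ℝ, AlphaCF.IsEta n k v.word η → AlphaCF.IsZeta n k v.word ζ →
        η < ζ ∧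
        AlphaCF.cylinder n k v.word = Set.Ico η ζ ∪
          ⋃ q ∈ AlphaCF.thetaIndices v, AlphaCF.cylinder n k (AlphaCF.Theta q v).word ∧
        (∀ q ∈ AlphaCF.thetaIndices v,
          Disjoint (Set.Ico η ζ) (AlphaCF.cylinder n k (AlphaCF.Theta q v).word)) ∧
        (AlphaCF.thetaIndices v).PairwiseDisjoint
          (fun q => AlphaCF.cylinder n k (AlphaCF.Theta q v).word) := by
  open AlphaCF in
  have ht := two_le_tPar hn
  refine ⟨?_, fun ε hε => Ico_epsilon_eq ht hε, pairwiseDisjoint_cylinder n, ?_⟩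
  · obtain ⟨r, r1, r2, r3⟩ := exists_epsilon_root ht
    simp only [isEpsilon_iff]
    exact existsUnique_param ht r1 r2 r3
  intro k hk v hv
  obtain ⟨u, p, hrep⟩ := hv.exists_represents (-(k : ℤ))
  have he : -(k : ℤ) ≤ -2 := by lia
  have hword : lowerDigits k v.word = u ++ (p ++ [-(k : ℤ)]) := by
    rw [lowerDigits_eq_blocks, hrep.word]
  have hchild : ∀ q ∈ thetaIndices v, lowerDigits k (Theta q v).word =
      u ++ (p ++ [-(k : ℤ)]) ++
        (wpow (p ++ (-(k : ℤ) - 1) :: u) (childIndex v q) ++ (p ++ [-(k : ℤ)])) := by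
    intro q hq
    rw [lowerDigits_eq_blocks, (hrep.child hq).word]
    simp
  have hlet := lowerDigits_le hk v.word
  rw [hword] at hlet
  have hnode := hrep.isNode
  have hne : u ++ (p ++ [-(k : ℤ)]) ≠ [] := by simp
  obtain ⟨a, a1, a2, a3⟩ := exists_etaPoly_root ht hlet hne
  obtain ⟨b, b1, b2, b3⟩ := exists_zetaPoly_root ht hlet hne
  simp only [isEta_iff ht, isZeta_iff, hword]
  refine ⟨existsUnique_param ht a1 a2 a3, existsUnique_param ht b1 b2 b3, ?_⟩
  rintro η ζ ⟨hη, hη0⟩ ⟨hζ, hζ0⟩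
  -- The interval `[η, ζ)` is the part of the cylinder to the right of the synchronization point.
  have hJ : ∀ α, α ∈ Set.Ico η ζ ↔ α ∈ cylinder n k v.word ∧ syncPoint (tPar n) (ell0 n α) ≤
      digitOrbit (tPar n) (ell0 n α) (u ++ (p ++ [-(k : ℤ)])) := by
    intro α
    rw [mem_cylinder_iff ht hk, hword, and_assoc]
    constructor
    · rintro ⟨h1, h2⟩
      have hα : α ∈ Set.Icc (0 : ℝ) 1 := ⟨hη.1.trans h1, h2.le.trans hζ.2⟩
      obtain ⟨x1, x2⟩ := ell0_mem ht hα
      refine ⟨hα, (hnode.sync_iff ht he x1 x2).2 ⟨?_, ?_⟩⟩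
      · rw [← not_lt, pos_iff_lt_param ht a3 hα hη hη0]
        exact not_lt.2 h1
      · rwa [pos_iff_lt_param ht b3 hα hζ hζ0]
    · rintro ⟨hα, h⟩
      obtain ⟨x1, x2⟩ := ell0_mem ht hα
      rw [hnode.sync_iff ht he x1 x2, ← not_lt, pos_iff_lt_param ht a3 hα hη hη0, not_lt,
        pos_iff_lt_param ht b3 hα hζ hζ0] at h
      exact h
  have hC : ∀ q ∈ thetaIndices v, ∀ α, α ∈ cylinder n k (Theta q v).word ↔
      α ∈ Set.Icc (0 : ℝ) 1 ∧ Follows (tPar n) (ell0 n α) (ell0 n α)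
        (u ++ (p ++ [-(k : ℤ)]) ++
          (wpow (p ++ (-(k : ℤ) - 1) :: u) (childIndex v q) ++ (p ++ [-(k : ℤ)]))) := by
    intro q hq α
    rw [mem_cylinder_iff ht hk, hchild q hq]
  refine ⟨?_, ?_, ?_, ?_⟩
  · obtain ⟨x1, x2⟩ := ell0_mem ht hη
    have hx := (a3 _ x1 x2).2.1 hη0
    rw [← pos_iff_lt_param ht b3 hη hζ hζ0]
    exact zetaPoly_pos_of_etaPoly_eq_zero ht hlet hne (by linarith) (by linarith) hη0
  · ext α
    simp only [Set.mem_union, Set.mem_iUnion, exists_prop]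
    constructor
    · intro h
      rcases le_or_gt (syncPoint (tPar n) (ell0 n α))
        (digitOrbit (tPar n) (ell0 n α) (u ++ (p ++ [-(k : ℤ)]))) with hle | hlt
      · exact Or.inl ((hJ α).2 ⟨h, hle⟩)
      · right
        obtain ⟨hα, hf⟩ := (mem_cylinder_iff ht hk).1 h
        rw [hword] at hf
        obtain ⟨x1, x2⟩ := ell0_mem ht hα
        have hm1 : -1 ≤ ell0 n α := by
          obtain ⟨y, hy, -⟩ := hnode.exists_cons
          rw [hy] at hf
          exact neg_one_le ht he x1 hf.1 hf.2.1
        obtain ⟨j, hj⟩ := hnode.exists_follows ht hm1 hf hlt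
        obtain ⟨q, hq, rfl⟩ := childIndex_surjOn v j
        exact ⟨q, hq, (hC q hq α).2 ⟨hα, hj⟩⟩
    · rintro (h | ⟨q, hq, h⟩)
      · exact ((hJ α).1 h).1
      · rw [hC q hq] at h
        rw [mem_cylinder_iff ht hk, hword]
        exact ⟨h.1, (follows_append.1 h.2).1⟩
  · intro q hq
    refine Set.disjoint_left.2 fun α h h' => ?_
    rw [hC q hq] at h'
    exact absurd (hnode.lt_syncPoint ht h'.2) (not_lt.2 ((hJ α).1 h).2)
  · intro q hq q' hq' hqq
    refine Set.disjoint_left.2 fun α h h' => hqq ?_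
    simp only [hC q hq, hC q' hq'] at h h'
    exact childIndex_injOn v hq hq'
      (child_index_unique (follows_append.1 h.2).2 (follows_append.1 h'.2).2)
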